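/- **Computational adequacy of Proto-Quipper-C.** Let $\mathcal M$ be a strict symmetric premonoidal category (tensor $\otimes$, unit $I$, actions $X\rtimes f$ and $f\ltimes X$, no interchange law, central symmetries) and let every wire type $w$ be assigned an object $\llbracket w\rrbracket$ of $\mathcal M$. A label context $Q=\ell_1:w_1,\dots,\ell_n:w_n$ (distinct labels) denotes $\llbracket w_1\rrbracket\otimes\dots\otimes\llbracket w_n\rrbracket$, and a labelled circuit $C:Q\to L$ is a morphism $\llbracket Q\rrbracket\to\llbracket L\rrbracket$ of $\mathcal M$. *Language.* Bundle types are $T,U::=\mathbb 1\mid w\mid T\otimes U$; parameter types are $P,R::=\mathbb 1\mid\mathsf{Nat}\mid P\otimes R\mid{!A}\mid\mathrm{Circ}(T,U)$; types are $A,B::=P\mid T\mid A\otimes B\mid A\multimap_T B$, where the closure annotation $T$ (the type of the captured wires) is taken up to the associativity and unit laws of $\otimes$. Values are $V,W::=*\mid n\mid x\mid\ell\mid\lambda x_A.M\mid\mathsf{lift}\,M\mid(\vec\ell,C,\vec k)\mid\langle V,W\rangle$, where $(\vec\ell,C,\vec k)$ is a boxed circuit with interfaces the wire bundles $\vec\ell,\vec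 k$. Computations are $M,N::=V\,W\mid\mathsf{force}\,V\mid\mathsf{box}_T V\mid\mathsf{apply}(V,W)\mid\mathsf{let}\,\langle x,y\rangle=V\,\mathsf{in}\,M\mid\mathsf{ifz}\,V\,M\,N\mid\mathsf{return}\,V\mid\mathsf{let}\,x=M\,\mathsf{in}\,N$. The judgments $\Gamma\vdash V:A$ and $\Gamma\vdash M:A$ are those of a linear call-by-value type system with ordered contexts of variables and labels, in which only contexts $\Phi$ of variables of parameter type may be duplicated or discarded, exchange is a rule for computations, and $\lambda x_A.M$ has type $A\multimap_{\sharp\Gamma}B$ in context $\Gamma$ when $\Gamma,x:A\vdash M:B$. The big-step relation $(C,M)\Downarrow(D,V)$ evaluates $M$ while extending the circuit $C$: $\mathsf{apply}$ appends a relabelled copy of a boxed circuit to the current one, and $\mathsf{box}_T V$ evaluates $V\,\vec\ell$ on fresh labels $\vec\ell:T$, starting from the identity circuit, and returns the resulting boxed circuit; the other rules are the usual ones. Write $Q\vdash(C,M):A;Q'$ if $C$ is a circuit from $Q$ to (a permutation of) $L,Q'$ for some label context $L$ disjoint from $Q'$ with $L\vdash M:A$, and similarly for $(C,V)$ with $V$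 a value. *Semantics.* Every type $A$ denotes a pair $(\flat\llbracket A\rrbracket,\sharp\llbracket A\rrbracket)$ of a set and an object of $\mathcal M$, with $$\flat\llbracket\mathrm{Circ}(T,U)\rrbracket=\mathcal M(\llbracket T\rrbracket,\llbracket U\rrbracket),\qquad \flat\llbracket A\multimap_T B\rrbracket=\flat\llbracket A\rrbracket\to\flat\llbracket B\rrbracket\times\mathcal M(\llbracket T\rrbracket\otimes\sharp\llbracket A\rrbracket,\sharp\llbracket B\rrbracket),\qquad \sharp\llbracket A\multimap_T B\rrbracket=\llbracket T\rrbracket,$$ $\sharp$ being $I$ on parameter types, $\llbracket w\rrbracket$ on wires, and multiplicative on $\otimes$. Let $\mathcal T(S,U,X)=X\times\mathcal M(S,U)$ be the circuit indexed monad, $\mathbf{Set}_{\mathcal T}$ its Kleisli category, whose morphisms $(X,S)\to(Y,U)$ are the functions $X\to Y\times\mathcal M(S,U)$, and $J:\mathbf{Set}\times\mathcal M\to\mathbf{Set}_{\mathcal T}$, $J(f,c)(x)=(f(x),c)$. A derivation of $\Gamma\vdash V:A$ denotes a function $\flat\llbracket\Gamma\rrbracket\to\flat\llbracket A\rrbracket$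 together with the identity of $\sharp\llbracket\Gamma\rrbracket=\sharp\llbracket A\rrbracket$. A derivation of $\Gamma\vdash M:A$ denotes a morphism of $\mathbf{Set}_{\mathcal T}$ from $\llbracket\Gamma\rrbracket$ to $\llbracket A\rrbracket$. Finally, writing $\mathbf{perm}$ for the permutation isomorphism from the codomain of $C$ to $\llbracket L,Q'\rrbracket$ and $;$ for composition in diagrammatic order, $\llbracket(C,M)\rrbracket=J(\mathrm{id}_1,C;\mathbf{perm});(\llbracket M\rrbracket\ltimes\llbracket Q'\rrbracket)$ in $\mathbf{Set}_{\mathcal T}$ and $\llbracket(D,V)\rrbracket=(\mathrm{id}_1,D;\mathbf{perm});(\llbracket V\rrbracket\ltimes\llbracket Q'\rrbracket)$ in $\mathbf{Set}\times\mathcal M$. **Theorem.** Suppose that $\emptyset\vdash(C,M):\mathbb 1;\emptyset$ and $\emptyset\vdash(D,V):\mathbb 1;\emptyset$, where $V$ is a value, and that $\llbracket(C,M)\rrbracket=J(\llbracket(D,V)\rrbracket)$ (for any choice of typing derivations). Then $(C,M)\Downarrow(D,V)$. (No renaming of labels is needed here, since the interfaces of $D$ are empty and $V$ has type $\mathbb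 1$.) -/

import Mathlib

open CategoryTheory

universe v u w

/-!
Syntax, type system, operational semantics and denotational semantics of Proto-Quipper-C,
over an arbitrary strict symmetric premonoidal category of circuits.
-/

namespace PQC

/-! ### Circuits: strict symmetric premonoidal categories -/

/-- A strict symmetric premonoidal category.  The objects form a monoid `(𝓜, *, 1)` (tensor and
unit).  `wL X f` is `X ⋊ f` and `wR f X` is `f ⋉ X`.  Interchange is *not* assumed; only the
symmetry is required to be central.  Strictness is expressed by heterogeneous equality, that is
equality on the nose. -/
class StrictSymmPremonoidal (𝓜 : Type u) extends Category.{v} 𝓜, Monoid 𝓜 where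
  wL : ∀ (X : 𝓜) {Y Z : 𝓜}, (Y ⟶ Z) → (X * Y ⟶ X * Z)
  wR : ∀ {Y Z : 𝓜}, (Y ⟶ Z) → ∀ X : 𝓜, (Y * X ⟶ Z * X)
  wL_id : ∀ X Y : 𝓜, wL X (𝟙 Y) = 𝟙 (X * Y)
  wR_id : ∀ X Y : 𝓜, wR (𝟙 Y) X = 𝟙 (Y * X)
  wL_comp : ∀ (X : 𝓜) {Y Z U : 𝓜} (f : Y ⟶ Z) (g : Z ⟶ U), wL X (f ≫ g) = wL X f ≫ wL X g
  wR_comp : ∀ {Y Z U : 𝓜} (f : Y ⟶ Z) (g : Z ⟶ U) (X : 𝓜), wR (f ≫ g) X = wR f X ≫ wR g X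
  wL_unit : ∀ {Y Z : 𝓜} (f : Y ⟶ Z), HEq (wL 1 f) f
  wR_unit : ∀ {Y Z : 𝓜} (f : Y ⟶ Z), HEq (wR f 1) f
  wL_tensor : ∀ (X X' : 𝓜) {Y Z : 𝓜} (f : Y ⟶ Z), HEq (wL (X * X') f) (wL X (wL X' f))
  wR_tensor : ∀ {Y Z : 𝓜} (f : Y ⟶ Z) (X X' : 𝓜), HEq (wR f (X * X')) (wR (wR f X) X')
  wL_wR : ∀ (X : 𝓜) {Y Z : 𝓜} (f : Y ⟶ Z) (X' : 𝓜), HEq (wL X (wR f X')) (wR (wL X f) X')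
  symm : ∀ X Y : 𝓜, X * Y ⟶ Y * X
  symm_symm : ∀ X Y : 𝓜, symm X Y ≫ symm Y X = 𝟙 (X * Y)
  symm_natural_left : ∀ {X X' : 𝓜} (f : X ⟶ X') (Y : 𝓜),
    wR f Y ≫ symm X' Y = symm X Y ≫ wL Y f
  symm_natural_right : ∀ (X : 𝓜) {Y Y' : 𝓜} (f : Y ⟶ Y'),
    wL X f ≫ symm X Y' = symm X Y ≫ wR f X
  symm_central_left : ∀ (X Y : 𝓜) {Z Z' : 𝓜} (f : Z ⟶ Z'),
    wR (symm X Y) Z ≫ wL (Y * X) f = wL (X * Y) f ≫ wR (symm X Y) Z'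
  symm_central_right : ∀ (X Y : 𝓜) {Z Z' : 𝓜} (f : Z ⟶ Z'),
    wL Z (symm X Y) ≫ wR f (Y * X) = wR f (X * Y) ≫ wL Z' (symm X Y)
  hexagon : ∀ X Y Z : 𝓜, symm X (Y * Z) =
    eqToHom (mul_assoc X Y Z).symm ≫ wR (symm X Y) Z ≫ eqToHom (mul_assoc Y X Z) ≫
      wL Y (symm X Z) ≫ eqToHom (mul_assoc Y Z X).symm

open StrictSymmPremonoidal

section Circuits

variable {W : Type w} {𝓜 : Type u} [StrictSymmPremonoidal.{v} 𝓜] (ι : W → 𝓜)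

/-- The object of `𝓜` denoted by a sequence of wire types. -/
def obs (l : List W) : 𝓜 := (l.map ι).prod

theorem obs_append (l m : List W) : obs ι (l ++ m) = obs ι l * obs ι m := by
  simp [obs]

/-- The identity circuit between two equal sequences of wire types. -/
def same {l m : List W} (h : l = m) : obs ι l ⟶ obs ι m := eqToHom (congrArg (obs ι) h)

variable {ι}

/-- `m ⋊ f`. -/
def padL (m : List W) {l l' : List W} (f : obs ι l ⟶ obs ι l') :
    obs ι (m ++ l) ⟶ obs ι (m ++ l') :=
  eqToHom (obs_append ι m l) ≫ wL (obs ι m) f ≫ eqToHom (obs_append ι m l').symm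

/-- `f ⋉ m`. -/
def padR {l l' : List W} (f : obs ι l ⟶ obs ι l') (m : List W) :
    obs ι (l ++ m) ⟶ obs ι (l' ++ m) :=
  eqToHom (obs_append ι l m) ≫ wR f (obs ι m) ≫ eqToHom (obs_append ι l' m).symm

variable (ι)

/-- The symmetry exchanging two blocks of wires. -/
def swapBlocks (l m : List W) : obs ι (l ++ m) ⟶ obs ι (m ++ l) :=
  eqToHom (obs_append ι l m) ≫ symm (obs ι l) (obs ι m) ≫ eqToHom (obs_append ι m l).symm

end Circuits

/-! ### Label contexts and labelled circuits -/

/-- Wire labels. -/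
abbrev Label := ℕ

/-- Label contexts `ℓ₁ : w₁, …, ℓₙ : wₙ`.  Distinctness of the labels is imposed by the typing
judgments. -/
abbrev LCtx (W : Type w) := List (Label × W)

/-- The sequence of wire types of a label context. -/
abbrev LCtx.wires {W : Type w} (Q : LCtx W) : List W := List.map Prod.snd Q

/-- Renaming of labels in a label context. -/
def LCtx.rename {W : Type w} (ρ : Label → Label) (Q : LCtx W) : LCtx W :=
  List.map (fun p => (ρ p.1, p.2)) Q

theorem LCtx.wires_rename {W : Type w} (ρ : Label → Label) (Q : LCtx W) :
    (Q.rename ρ).wires = Q.wires := by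
  simp [LCtx.rename, LCtx.wires]

theorem LCtx.wires_append {W : Type w} (Q R : LCtx W) :
    LCtx.wires (Q ++ R) = Q.wires ++ R.wires := by
  simp [LCtx.wires]

/-- Permutations `Q ≅_σ Q'` of label contexts, as data. -/
inductive LPerm {W : Type w} : LCtx W → LCtx W → Type w
  | nil : LPerm [] []
  | cons (a : Label × W) {Q R : LCtx W} : LPerm Q R → LPerm (a :: Q) (a :: R)
  | swap (a b : Label × W) (Q : LCtx W) : LPerm (a :: b :: Q) (b :: a :: Q)
  | trans {Q R S : LCtx W} : LPerm Q R → LPerm R S → LPerm Q S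

section LabelledCircuits

variable {W : Type w} {𝓜 : Type u} [StrictSymmPremonoidal.{v} 𝓜] (ι : W → 𝓜)

/-- Labelled circuits `C : Q → L`: morphisms of `𝓜` between the interpretations of `Q` and `L`. -/
abbrev Circ (Q L : LCtx W) : Type v := obs ι Q.wires ⟶ obs ι L.wires

/-- The permutation isomorphism of `𝓜` induced by a permutation of label contexts. -/
def LPerm.perm : {Q R : LCtx W} → LPerm Q R → Circ ι Q R
  | _, _, .nil => 𝟙 _
  | _, _, .cons a σ => padL [a.2] σ.perm
  | _, _, .swap a b Q => padR (swapBlocks ι [a.2] [b.2]) Q.wires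
  | _, _, .trans σ τ => σ.perm ≫ τ.perm

end LabelledCircuits

/-! ### Types -/

/-- Bundle types `T, U ::= 𝟙 | w | T ⊗ U`. -/
inductive BTy (W : Type w) : Type w
  | unit : BTy W
  | wire (a : W) : BTy W
  | tensor (T U : BTy W) : BTy W

/-- Types.  In `arrow A B T` (the closure type `A ⊸_T B`) the annotation `T` is the type of the
wires captured by the closure; it is a bundle type up to associativity and unit laws of `⊗`, that
is a finite sequence of wire types. -/
inductive Ty (W : Type w) : Type w
  | unit : Ty W
  | nat : Ty W
  | wire (a : W) : Ty W
  | tensor (A B : Ty W) : Ty W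
  | bang (A : Ty W) : Ty W
  | circ (T U : BTy W) : Ty W
  | arrow (A B : Ty W) (T : List W) : Ty W

/-- Bundle types are types. -/
def BTy.toTy {W : Type w} : BTy W → Ty W
  | .unit => .unit
  | .wire a => .wire a
  | .tensor T U => .tensor T.toTy U.toTy

/-- Parameter types `P, R ::= 𝟙 | Nat | P ⊗ R | !A | Circ(T, U)`. -/
def Ty.IsParam {W : Type w} : Ty W → Prop
  | .unit => True
  | .nat => True
  | .wire _ => False
  | .tensor A B => A.IsParam ∧ B.IsParam
  | .bang _ => True
  | .circ _ _ => True
  | .arrow _ _ _ => False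

/-- The circuit part `♯A` of a type. -/
def Ty.wires {W : Type w} : Ty W → List W
  | .unit => []
  | .nat => []
  | .wire a => [a]
  | .tensor A B => A.wires ++ B.wires
  | .bang _ => []
  | .circ _ _ => []
  | .arrow _ _ T => T

/-- The wires of a bundle type. -/
abbrev BTy.wires {W : Type w} (T : BTy W) : List W := T.toTy.wires

theorem Ty.IsParam.wires_eq_nil {W : Type w} : ∀ {A : Ty W}, A.IsParam → A.wires = []
  | .unit, _ => rfl
  | .nat, _ => rfl
  | .tensor _ _, h => by simp [Ty.wires, h.1.wires_eq_nil, h.2.wires_eq_nil]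
  | .bang _, _ => rfl
  | .circ _ _, _ => rfl

/-! ### Terms (locally nameless: bound variables are de Bruijn indices) -/

/-- Wire bundles `ℓ⃗ ::= * | ℓ | (ℓ⃗, k⃗)`. -/
inductive Bundle : Type
  | unit : Bundle
  | lab (l : Label) : Bundle
  | pair (a b : Bundle) : Bundle

/-- Renaming of labels in a wire bundle. -/
def Bundle.rename (ρ : Label → Label) : Bundle → Bundle
  | .unit => .unit
  | .lab l => .lab (ρ l)
  | .pair a b => .pair (a.rename ρ) (b.rename ρ)

section Terms

variable {W : Type w} {𝓜 : Type u} [StrictSymmPremonoidal.{v} 𝓜] (ι : W → 𝓜)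

mutual

/-- Values. `boxed ℓ C k` is the boxed circuit `(ℓ⃗, C, k⃗)`. -/
inductive Val : Type (max v w)
  | unit : Val
  | nat (n : ℕ) : Val
  | bvar (i : ℕ) : Val
  | fvar (x : ℕ) : Val
  | lab (l : Label) : Val
  | lam (A : Ty W) (M : Comp) : Val
  | lift (M : Comp) : Val
  | boxed (l : Bundle) {Q L : LCtx W} (C : Circ ι Q L) (k : Bundle) : Val
  | pair (V₁ V₂ : Val) : Val

/-- Computations.  `lam A M` binds index `0` in `M`, and `letin M N` binds index `0` in `N`;
`dest V M`, which is `let (x, y) = V in M`, binds `x` as index `1` and `y` as index `0`. -/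
inductive Comp : Type (max v w)
  | app (V₁ V₂ : Val) : Comp
  | force (V : Val) : Comp
  | box (T : BTy W) (V : Val) : Comp
  | apply (V₁ V₂ : Val) : Comp
  | dest (V : Val) (M : Comp) : Comp
  | ifz (V : Val) (M N : Comp) : Comp
  | ret (V : Val) : Comp
  | letin (M N : Comp) : Comp

end

variable {ι}

/-- Wire bundles are values. -/
def Bundle.toVal : Bundle → Val ι
  | .unit => .unit
  | .lab l => .lab l
  | .pair a b => .pair a.toVal b.toVal

mutual

/-- Replace the bound variable `i` by the (locally closed) value `X`. -/
def Val.opn (X : Val ι) : ℕ → Val ι → Val ι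
  | _, .unit => .unit
  | _, .nat n => .nat n
  | i, .bvar j => if j = i then X else .bvar j
  | _, .fvar x => .fvar x
  | _, .lab l => .lab l
  | i, .lam A M => .lam A (M.opn X (i + 1))
  | i, .lift M => .lift (M.opn X i)
  | _, .boxed l C k => .boxed l C k
  | i, .pair V₁ V₂ => .pair (Val.opn X i V₁) (Val.opn X i V₂)

/-- Replace the bound variable `i` by the (locally closed) value `X`. -/
def Comp.opn (X : Val ι) : ℕ → Comp ι → Comp ι
  | i, .app V₁ V₂ => .app (Val.opn X i V₁) (Val.opn X i V₂)
  | i, .force V => .force (Val.opn X i V)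
  | i, .box T V => .box T (Val.opn X i V)
  | i, .apply V₁ V₂ => .apply (Val.opn X i V₁) (Val.opn X i V₂)
  | i, .dest V M => .dest (Val.opn X i V) (Comp.opn X (i + 2) M)
  | i, .ifz V M N => .ifz (Val.opn X i V) (Comp.opn X i M) (Comp.opn X i N)
  | i, .ret V => .ret (Val.opn X i V)
  | i, .letin M N => .letin (Comp.opn X i M) (Comp.opn X (i + 1) N)

end

mutual

/-- Free variables. -/
def Val.fv : Val ι → Finset ℕ
  | .unit => ∅
  | .nat _ => ∅
  | .bvar _ => ∅
  | .fvar x => {x}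
  | .lab _ => ∅
  | .lam _ M => M.fv
  | .lift M => M.fv
  | .boxed _ _ _ => ∅
  | .pair V₁ V₂ => V₁.fv ∪ V₂.fv

/-- Free variables. -/
def Comp.fv : Comp ι → Finset ℕ
  | .app V₁ V₂ => V₁.fv ∪ V₂.fv
  | .force V => V.fv
  | .box _ V => V.fv
  | .apply V₁ V₂ => V₁.fv ∪ V₂.fv
  | .dest V M => V.fv ∪ M.fv
  | .ifz V M N => V.fv ∪ M.fv ∪ N.fv
  | .ret V => V.fv
  | .letin M N => M.fv ∪ N.fv

end

mutual

/-- Labels occurring in a value, outside boxed circuits. -/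
def Val.labels : Val ι → Finset Label
  | .unit => ∅
  | .nat _ => ∅
  | .bvar _ => ∅
  | .fvar _ => ∅
  | .lab l => {l}
  | .lam _ M => M.labels
  | .lift M => M.labels
  | .boxed _ _ _ => ∅
  | .pair V₁ V₂ => V₁.labels ∪ V₂.labels

/-- Labels occurring in a computation, outside boxed circuits. -/
def Comp.labels : Comp ι → Finset Label
  | .app V₁ V₂ => V₁.labels ∪ V₂.labels
  | .force V => V.labels
  | .box _ V => V.labels
  | .apply V₁ V₂ => V₁.labels ∪ V₂.labels
  | .dest V M => V.labels ∪ M.labels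
  | .ifz V M N => V.labels ∪ M.labels ∪ N.labels
  | .ret V => V.labels
  | .letin M N => M.labels ∪ N.labels

end

end Terms

/-! ### Typing contexts -/

/-- Entries of a typing context: `x : A` for a variable `x`, or `ℓ : w` for a label `ℓ`. -/
inductive Entry (W : Type w) : Type w
  | var (x : ℕ) (A : Ty W) : Entry W
  | lab (l : Label) (a : W) : Entry W

/-- The name declared by an entry. -/
def Entry.name {W : Type w} : Entry W → ℕ ⊕ Label
  | .var x _ => .inl x
  | .lab l _ => .inr l

/-- The type declared by an entry. -/
def Entry.ty {W : Type w} : Entry W → Ty W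
  | .var _ A => A
  | .lab _ a => .wire a

/-- Typing contexts: ordered sequences of entries. -/
abbrev Ctx (W : Type w) := List (Entry W)

/-- The declared names are pairwise distinct. -/
def Ctx.WF {W : Type w} (Γ : Ctx W) : Prop := (List.map Entry.name Γ).Nodup

/-- Parameter contexts: variables of parameter types only. -/
def Ctx.IsParam {W : Type w} (Γ : Ctx W) : Prop :=
  ∀ e ∈ Γ, ∃ (x : ℕ) (A : Ty W), e = .var x A ∧ A.IsParam

/-- The circuit part `♯Γ` of a context. -/
def Ctx.wires {W : Type w} (Γ : Ctx W) : List W := List.flatMap (fun e => e.ty.wires) Γ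

/-- Label contexts are typing contexts. -/
def LCtx.toCtx {W : Type w} (Q : LCtx W) : Ctx W := List.map (fun p => Entry.lab p.1 p.2) Q

theorem Ctx.wires_append {W : Type w} (Γ Δ : Ctx W) :
    Ctx.wires (Γ ++ Δ) = Ctx.wires Γ ++ Ctx.wires Δ := by
  simp [Ctx.wires]

theorem Ctx.wires_single {W : Type w} (e : Entry W) : Ctx.wires [e] = e.ty.wires := by
  simp [Ctx.wires]

theorem Ctx.IsParam.wires_eq_nil {W : Type w} {Φ : Ctx W} (h : Φ.IsParam) : Φ.wires = [] := by
  simp only [Ctx.wires, List.flatMap_eq_nil_iff]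
  intro e he
  obtain ⟨x, A, rfl, hA⟩ := h e he
  exact hA.wires_eq_nil

theorem LCtx.wires_toCtx {W : Type w} (Q : LCtx W) : Q.toCtx.wires = Q.wires := by
  induction Q with
  | nil => rfl
  | cons a Q ih =>
    have h : Ctx.wires (LCtx.toCtx (a :: Q)) = a.2 :: Ctx.wires (LCtx.toCtx Q) := rfl
    rw [h, ih]
    rfl

/-! ### Typing judgments

Derivations are data, because the denotational semantics is defined on them. -/

section Typing

variable {W : Type w} {𝓜 : Type u} [StrictSymmPremonoidal.{v} 𝓜] {ι : W → 𝓜}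

mutual

/-- `Γ ⊢ V : A` for values. -/
inductive VTy : Ctx W → Val ι → Ty W → Type (max v w)
  | unit {Φ : Ctx W} (hΦ : Φ.IsParam) (hn : Φ.WF) : VTy Φ .unit .unit
  | nat {Φ : Ctx W} (hΦ : Φ.IsParam) (hn : Φ.WF) (n : ℕ) : VTy Φ (.nat n) .nat
  | lab {Φ : Ctx W} (hΦ : Φ.IsParam) (l : Label) (a : W)
      (hn : Ctx.WF (Φ ++ [.lab l a])) : VTy (Φ ++ [.lab l a]) (.lab l) (.wire a)
  | var {Φ : Ctx W} (hΦ : Φ.IsParam) (x : ℕ) (A : Ty W)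
      (hn : Ctx.WF (Φ ++ [.var x A])) : VTy (Φ ++ [.var x A]) (.fvar x) A
  | abs {Γ : Ctx W} {A B : Ty W} {M : Comp ι} (x : ℕ) (hx : x ∉ M.fv)
      (d : CTy (Γ ++ [.var x A]) (M.opn (.fvar x) 0) B) :
      VTy Γ (.lam A M) (.arrow A B Γ.wires)
  | lift {Φ : Ctx W} (hΦ : Φ.IsParam) {M : Comp ι} {A : Ty W} (d : CTy Φ M A) :
      VTy Φ (.lift M) (.bang A)
  | circ {Φ : Ctx W} (hΦ : Φ.IsParam) (hn : Φ.WF) {Q Q' L L' : LCtx W} (C : Circ ι Q L)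
      (σ : LPerm Q' Q) (τ : LPerm L L') {l k : Bundle} {T U : BTy W}
      (dl : VTy Q'.toCtx l.toVal T.toTy) (dk : VTy L'.toCtx k.toVal U.toTy) :
      VTy Φ (.boxed l C k) (.circ T U)
  | pair {Φ Γ₁ Γ₂ : Ctx W} (hΦ : Φ.IsParam) (hn : Ctx.WF (Φ ++ Γ₁ ++ Γ₂))
      {V₁ V₂ : Val ι} {A B : Ty W} (d₁ : VTy (Φ ++ Γ₁) V₁ A) (d₂ : VTy (Φ ++ Γ₂) V₂ B) :
      VTy (Φ ++ Γ₁ ++ Γ₂) (.pair V₁ V₂) (.tensor A B)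

/-- `Γ ⊢ M : A` for computations. -/
inductive CTy : Ctx W → Comp ι → Ty W → Type (max v w)
  | app {Φ Γ₁ Γ₂ : Ctx W} (hΦ : Φ.IsParam) (hn : Ctx.WF (Φ ++ Γ₁ ++ Γ₂))
      {V₁ V₂ : Val ι} {A B : Ty W} {T : List W}
      (d₁ : VTy (Φ ++ Γ₁) V₁ (.arrow A B T)) (d₂ : VTy (Φ ++ Γ₂) V₂ A) :
      CTy (Φ ++ Γ₁ ++ Γ₂) (.app V₁ V₂) B
  | force {Φ : Ctx W} (hΦ : Φ.IsParam) {V : Val ι} {A : Ty W} (d : VTy Φ V (.bang A)) :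
      CTy Φ (.force V) A
  | box {Φ : Ctx W} (hΦ : Φ.IsParam) {V : Val ι} {T U : BTy W}
      (d : VTy Φ V (.arrow T.toTy U.toTy [])) : CTy Φ (.box T V) (.circ T U)
  | apply {Φ Γ₁ Γ₂ : Ctx W} (hΦ : Φ.IsParam) (hn : Ctx.WF (Φ ++ Γ₁ ++ Γ₂))
      {V₁ V₂ : Val ι} {T U : BTy W}
      (d₁ : VTy (Φ ++ Γ₁) V₁ (.circ T U)) (d₂ : VTy (Φ ++ Γ₂) V₂ T.toTy) :
      CTy (Φ ++ Γ₁ ++ Γ₂) (.apply V₁ V₂) U.toTy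
  | dest {Φ Γ₁ Γ₂ : Ctx W} (hΦ : Φ.IsParam) (hn : Ctx.WF (Φ ++ Γ₂ ++ Γ₁))
      {V : Val ι} {M : Comp ι} {A B C : Ty W} (x y : ℕ) (hx : x ∉ M.fv) (hy : y ∉ M.fv)
      (d₁ : VTy (Φ ++ Γ₁) V (.tensor A B))
      (d₂ : CTy (Φ ++ Γ₂ ++ [.var x A, .var y B])
        ((M.opn (.fvar x) 1).opn (.fvar y) 0) C) :
      CTy (Φ ++ Γ₂ ++ Γ₁) (.dest V M) C
  | ifz {Φ Γ : Ctx W} (hΦ : Φ.IsParam) {V : Val ι} {M N : Comp ι} {A : Ty W}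
      (d : VTy Φ V .nat) (d₁ : CTy (Φ ++ Γ) M A) (d₂ : CTy (Φ ++ Γ) N A) :
      CTy (Φ ++ Γ) (.ifz V M N) A
  | ret {Γ : Ctx W} {V : Val ι} {A : Ty W} (d : VTy Γ V A) : CTy Γ (.ret V) A
  | letin {Φ Γ₁ Γ₂ : Ctx W} (hΦ : Φ.IsParam) (hn : Ctx.WF (Φ ++ Γ₂ ++ Γ₁))
      {M N : Comp ι} {A B : Ty W} (x : ℕ) (hx : x ∉ N.fv)
      (d₁ : CTy (Φ ++ Γ₁) M A) (d₂ : CTy (Φ ++ Γ₂ ++ [.var x A]) (N.opn (.fvar x) 0) B) :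
      CTy (Φ ++ Γ₂ ++ Γ₁) (.letin M N) B
  | ex {Γ₁ Γ₂ : Ctx W} {a b : Entry W} {M : Comp ι} {C : Ty W}
      (d : CTy (Γ₁ ++ [a] ++ [b] ++ Γ₂) M C) : CTy (Γ₁ ++ [b] ++ [a] ++ Γ₂) M C

end

/-- A value judgment `Γ ⊢ V : A` satisfies `♯Γ = ♯A`: values are interpreted by identity
circuits. -/
theorem VTy.wires_eq {Γ : Ctx W} {V : Val ι} {A : Ty W} (d : VTy Γ V A) :
    Γ.wires = A.wires := by
  match d with
  | .unit hΦ _ => exact hΦ.wires_eq_nil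
  | .nat hΦ _ _ => exact hΦ.wires_eq_nil
  | .lab hΦ l a _ =>
    rw [Ctx.wires_append, hΦ.wires_eq_nil, Ctx.wires_single]; rfl
  | .var hΦ x A _ =>
    rw [Ctx.wires_append, hΦ.wires_eq_nil, Ctx.wires_single]; rfl
  | .abs _ _ _ => rfl
  | .lift hΦ _ => exact hΦ.wires_eq_nil
  | .circ hΦ _ _ _ _ _ _ => exact hΦ.wires_eq_nil
  | .pair hΦ _ d₁ d₂ =>
    have h₁ := d₁.wires_eq
    have h₂ := d₂.wires_eq
    simp only [Ctx.wires_append, hΦ.wires_eq_nil, List.nil_append] at h₁ h₂ ⊢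
    simp only [Ty.wires, h₁, h₂]

end Typing

/-! ### Operational semantics -/

section Evaluation

variable {W : Type w} {𝓜 : Type u} [StrictSymmPremonoidal.{v} 𝓜] {ι : W → 𝓜}

/-- Append `E : Q → L` to `C`: the codomain of `C` is permuted (by `σ`) into the inputs of `E`,
relabelled by `ρ`, followed by remaining wires `R`, to which `E` is not applied; the outputs of `E`
are relabelled by `ρ'`. -/
def append {Q₀ K Q L R : LCtx W} (C : Circ ι Q₀ K) (E : Circ ι Q L) (ρ ρ' : Label → Label)
    (σ : LPerm K (Q.rename ρ ++ R)) : Circ ι Q₀ (L.rename ρ' ++ R) :=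
  C ≫ σ.perm ι ≫ same ι (by rw [LCtx.wires_append, LCtx.wires_rename]) ≫
    padR E R.wires ≫ same ι (by rw [LCtx.wires_append, LCtx.wires_rename])

/-- Big-step evaluation `(C, M) ⇓ (D, V)`. -/
inductive Eval : {Q K : LCtx W} → Circ ι Q K → Comp ι →
    {K' : LCtx W} → Circ ι Q K' → Val ι → Prop
  | app {Q K K' : LCtx W} {C : Circ ι Q K} {D : Circ ι Q K'} {A : Ty W} {M : Comp ι}
      {X V : Val ι} : Eval C (M.opn X 0) D V → Eval C (.app (.lam A M) X) D V
  | dest {Q K K' : LCtx W} {C : Circ ι Q K} {D : Circ ι Q K'} {M : Comp ι} {X Y V : Val ι} :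
      Eval C ((M.opn X 1).opn Y 0) D V → Eval C (.dest (.pair X Y) M) D V
  | force {Q K K' : LCtx W} {C : Circ ι Q K} {D : Circ ι Q K'} {M : Comp ι} {V : Val ι} :
      Eval C M D V → Eval C (.force (.lift M)) D V
  | ifzZero {Q K K' : LCtx W} {C : Circ ι Q K} {D : Circ ι Q K'} {M N : Comp ι} {V : Val ι} :
      Eval C M D V → Eval C (.ifz (.nat 0) M N) D V
  | ifzSucc {Q K K' : LCtx W} {C : Circ ι Q K} {D : Circ ι Q K'} {M N : Comp ι} {V : Val ι}
      (n : ℕ) : Eval C N D V → Eval C (.ifz (.nat (n + 1)) M N) D V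
  | ret {Q K : LCtx W} {C : Circ ι Q K} {V : Val ι} : Eval C (.ret V) C V
  | letin {Q K K' K'' : LCtx W} {C : Circ ι Q K} {D : Circ ι Q K'} {E : Circ ι Q K''}
      {M N : Comp ι} {X V : Val ι} :
      Eval C M E X → Eval E (N.opn X 0) D V → Eval C (.letin M N) D V
  /- `box` runs the function on fresh labels of the input type, starting from the identity. -/
  | box {Q K : LCtx W} {C : Circ ι Q K} {T : BTy W} {V : Val ι} {l k : Bundle}
      {Q₁ L₁ : LCtx W} {D : Circ ι Q₁ L₁} (dl : VTy (ι := ι) Q₁.toCtx l.toVal T.toTy)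
      (fresh : ∀ p ∈ Q₁, p.1 ∉ V.labels) :
      Eval (𝟙 _ : Circ ι Q₁ Q₁) (.app V l.toVal) D k.toVal →
      Eval C (.box T V) C (.boxed l D k)
  /- `apply` appends a renamed copy of the boxed circuit, whose inputs are the argument labels and
  whose outputs do not clash with the remaining labels. -/
  | apply {Q K Q₁ L₁ R : LCtx W} {C : Circ ι Q K} {l k : Bundle} (E : Circ ι Q₁ L₁)
      (ρ ρ' : Label → Label) (σ : LPerm K (Q₁.rename ρ ++ R))
      (fresh : (List.map Prod.fst (L₁.rename ρ' ++ R)).Nodup) :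
      Eval C (.apply (.boxed l E k) (l.rename ρ).toVal) (append C E ρ ρ' σ) (k.rename ρ').toVal

end Evaluation

/-! ### Denotational semantics -/

section Semantics

variable {W : Type w} {𝓜 : Type u} [StrictSymmPremonoidal.{v} 𝓜]

/-- The circuit monad `𝒯(S, U, X) = X × 𝓜(S, U)`. -/
abbrev CircMonad (S U : 𝓜) (X : Type v) : Type v := X × (S ⟶ U)

/-- Morphisms `(X, S) → (Y, U)` of the Kleisli category of the circuit monad. -/
abbrev KHom (X : Type v) (S : 𝓜) (Y : Type v) (U : 𝓜) : Type v := X → CircMonad S U Y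

/-- Kleisli composition. -/
def KHom.comp {X Y Z : Type v} {S U R : 𝓜} (f : KHom X S Y U) (g : KHom Y U Z R) :
    KHom X S Z R :=
  fun x => ((g (f x).1).1, (f x).2 ≫ (g (f x).1).2)

/-- Morphisms `(X, S) → (Y, U)` of `Set × 𝓜`. -/
abbrev VHom (X : Type v) (S : 𝓜) (Y : Type v) (U : 𝓜) : Type v := (X → Y) × (S ⟶ U)

/-- The identity-on-objects functor `J : Set × 𝓜 → Set_𝒯`. -/
def J {X Y : Type v} {S U : 𝓜} (f : VHom X S Y U) : KHom X S Y U := fun x => (f.1 x, f.2)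

variable (ι : W → 𝓜)

/-- The parameter part `♭⟦A⟧` of the interpretation of a type. -/
def Ty.val : Ty W → Type v
  | .unit => PUnit.{v + 1}
  | .nat => ULift ℕ
  | .wire _ => PUnit.{v + 1}
  | .tensor A B => A.val × B.val
  | .bang A => PUnit.{v + 1} → CircMonad (obs ι []) (obs ι A.wires) A.val
  | .circ T U => obs ι T.wires ⟶ obs ι U.wires
  | .arrow A B T => A.val → CircMonad (obs ι (T ++ A.wires)) (obs ι B.wires) B.val

/-- The unique element of `♭⟦T⟧` for a bundle type `T`. -/
def BTy.pt : (T : BTy W) → T.toTy.val ι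
  | .unit => PUnit.unit
  | .wire _ => PUnit.unit
  | .tensor T U => (T.pt, U.pt)

/-- The parameter part `♭⟦Γ⟧` of the interpretation of a context. -/
def Ctx.val : Ctx W → Type v
  | [] => PUnit.{v + 1}
  | e :: Γ => e.ty.val ι × Ctx.val Γ

variable {ι}

/-- `♭⟦Γ, Δ⟧ → ♭⟦Γ⟧ × ♭⟦Δ⟧`. -/
def Ctx.split : (Γ : Ctx W) → {Δ : Ctx W} → Ctx.val ι (Γ ++ Δ) → Ctx.val ι Γ × Ctx.val ι Δ
  | [], _, g => (PUnit.unit, g)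
  | _ :: Γ, _, g => ((g.1, (Ctx.split Γ g.2).1), (Ctx.split Γ g.2).2)

/-- `♭⟦Γ⟧ × ♭⟦Δ⟧ → ♭⟦Γ, Δ⟧`. -/
def Ctx.join : {Γ Δ : Ctx W} → Ctx.val ι Γ → Ctx.val ι Δ → Ctx.val ι (Γ ++ Δ)
  | [], _, _, d => d
  | _ :: _, _, g, d => (g.1, Ctx.join g.2 d)

/-- Duplicate the parameter context: `♭⟦Φ, Γ₁, Γ₂⟧ → ♭⟦Φ, Γ₁⟧ × ♭⟦Φ, Γ₂⟧`. -/
def Ctx.dup (Φ Γ₁ Γ₂ : Ctx W) (g : Ctx.val ι (Φ ++ Γ₁ ++ Γ₂)) :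
    Ctx.val ι (Φ ++ Γ₁) × Ctx.val ι (Φ ++ Γ₂) :=
  let p := Ctx.split (Φ ++ Γ₁) g
  (p.1, Ctx.join (Ctx.split Φ p.1).1 p.2)

/-- Exchange two entries: `♭⟦Γ₁, b, a, Γ₂⟧ → ♭⟦Γ₁, a, b, Γ₂⟧`. -/
def Ctx.exch (Γ₁ Γ₂ : Ctx W) (a b : Entry W) (g : Ctx.val ι (Γ₁ ++ [b] ++ [a] ++ Γ₂)) :
    Ctx.val ι (Γ₁ ++ [a] ++ [b] ++ Γ₂) :=
  let p := Ctx.split (Γ₁ ++ [b] ++ [a]) g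
  let q := Ctx.split (Γ₁ ++ [b]) p.1
  let r := Ctx.split Γ₁ q.1
  Ctx.join (Ctx.join (Ctx.join r.1 q.2) r.2) p.2

/-- The permutation circuit `♯(Γ₁, b, a, Γ₂) → ♯(Γ₁, a, b, Γ₂)`. -/
def Ctx.exchPerm (ι : W → 𝓜) (Γ₁ Γ₂ : Ctx W) (a b : Entry W) :
    obs ι (Ctx.wires (Γ₁ ++ [b] ++ [a] ++ Γ₂)) ⟶ obs ι (Ctx.wires (Γ₁ ++ [a] ++ [b] ++ Γ₂)) :=
  same ι (by simp only [Ctx.wires_append, Ctx.wires_single, List.append_assoc]) ≫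
    padL Γ₁.wires (padR (swapBlocks ι b.ty.wires a.ty.wires) Γ₂.wires) ≫
    same ι (by simp only [Ctx.wires_append, Ctx.wires_single, List.append_assoc])

mutual

/-- The function `♭⟦Γ⟧ → ♭⟦A⟧` of a value judgment; the circuit component of its
interpretation is the identity of `♯Γ = ♯A`. -/
def VTy.sem : {Γ : Ctx W} → {V : Val ι} → {A : Ty W} → VTy Γ V A → Ctx.val ι Γ → A.val ι
  | _, _, _, .unit _ _, _ => PUnit.unit
  | _, _, _, .nat _ _ n, _ => ULift.up n
  | _, _, _, .lab (Φ := Φ) _ _ _ _, g => (Ctx.split Φ g).2.1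
  | _, _, _, .var (Φ := Φ) _ _ _ _, g => (Ctx.split Φ g).2.1
  | _, _, _, .abs (A := A) _ _ d, g => fun a =>
      let r := d.sem (Ctx.join g (a, PUnit.unit))
      (r.1, same ι (by rw [Ctx.wires_append, Ctx.wires_single]; rfl) ≫ r.2)
  | _, _, _, .lift hΦ d, g => fun _ =>
      let r := d.sem g
      (r.1, same ι hΦ.wires_eq_nil.symm ≫ r.2)
  | _, _, _, .circ _ _ C σ τ dl dk, _ =>
      same ι (dl.wires_eq.symm.trans (LCtx.wires_toCtx _)) ≫ σ.perm ι ≫ C ≫ τ.perm ι ≫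
        same ι ((LCtx.wires_toCtx _).symm.trans dk.wires_eq)
  | _, _, _, .pair (Φ := Φ) (Γ₁ := Γ₁) (Γ₂ := Γ₂) _ _ d₁ d₂, g =>
      (d₁.sem (Ctx.dup Φ Γ₁ Γ₂ g).1, d₂.sem (Ctx.dup Φ Γ₁ Γ₂ g).2)

/-- The interpretation `♭⟦Γ⟧ → ♭⟦A⟧ × 𝓜(♯Γ, ♯A)` of a computation judgment, a morphism
`⟦Γ⟧ → ⟦A⟧` of the Kleisli category of the circuit monad. -/
def CTy.sem : {Γ : Ctx W} → {M : Comp ι} → {A : Ty W} → CTy Γ M A →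
    KHom (Ctx.val ι Γ) (obs ι Γ.wires) (A.val ι) (obs ι A.wires)
  | _, _, _, .app (Φ := Φ) (Γ₁ := Γ₁) (Γ₂ := Γ₂) hΦ _ d₁ d₂, g =>
      let r := d₁.sem (Ctx.dup Φ Γ₁ Γ₂ g).1 (d₂.sem (Ctx.dup Φ Γ₁ Γ₂ g).2)
      (r.1, same ι (by
        have h₁ := d₁.wires_eq
        have h₂ := d₂.wires_eq
        simp only [Ctx.wires_append, hΦ.wires_eq_nil, List.nil_append, Ty.wires] at h₁ h₂ ⊢
        rw [h₁, h₂]) ≫ r.2)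
  | _, _, _, .force hΦ d, g =>
      let r := d.sem g PUnit.unit
      (r.1, same ι hΦ.wires_eq_nil ≫ r.2)
  | _, _, _, .box (T := T) hΦ d, g =>
      ((d.sem g (T.pt ι)).2, same ι hΦ.wires_eq_nil)
  | _, _, _, .apply (Φ := Φ) (Γ₁ := Γ₁) (Γ₂ := Γ₂) (T := T) (U := U) hΦ _ d₁ d₂, g =>
      (U.pt ι, same ι (by
        have h₁ := d₁.wires_eq
        have h₂ := d₂.wires_eq
        simp only [Ctx.wires_append, hΦ.wires_eq_nil, List.nil_append] at h₁ h₂ ⊢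
        rw [h₁, h₂]; rfl) ≫ d₁.sem (Ctx.dup Φ Γ₁ Γ₂ g).1)
  | _, _, _, .dest (Φ := Φ) (Γ₁ := Γ₁) (Γ₂ := Γ₂) hΦ _ _ _ _ _ d₁ d₂, g =>
      let p := d₁.sem (Ctx.join (Ctx.split Φ (Ctx.split (Φ ++ Γ₂) g).1).1
        (Ctx.split (Φ ++ Γ₂) g).2)
      let r := d₂.sem (Ctx.join (Ctx.split (Φ ++ Γ₂) g).1 (p.1, p.2, PUnit.unit))
      (r.1, same ι (by
        have h₁ := d₁.wires_eq
        simp only [Ctx.wires_append, hΦ.wires_eq_nil, List.nil_append] at h₁ ⊢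
        rw [h₁]
        simp [Ctx.wires, Entry.ty, Ty.wires]) ≫ r.2)
  | _, _, _, .ifz (Φ := Φ) _ d d₁ d₂, g =>
      match (d.sem (Ctx.split Φ g).1).down with
      | 0 => d₁.sem g
      | _ + 1 => d₂.sem g
  | _, _, _, .ret d, g => (d.sem g, same ι d.wires_eq)
  | _, _, _, .letin (Φ := Φ) (Γ₁ := Γ₁) (Γ₂ := Γ₂) hΦ _ _ _ d₁ d₂, g =>
      let r := d₁.sem (Ctx.dup Φ Γ₂ Γ₁ g).2
      let s := d₂.sem (Ctx.join (Ctx.dup Φ Γ₂ Γ₁ g).1 (r.1, PUnit.unit))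
      (s.1, same ι (by
          simp only [Ctx.wires_append, hΦ.wires_eq_nil, List.nil_append]) ≫
        padL Γ₂.wires r.2 ≫
        same ι (by
          simp only [Ctx.wires_append, Ctx.wires_single, hΦ.wires_eq_nil, List.nil_append]
          rfl) ≫ s.2)
  | _, _, _, .ex (Γ₁ := Γ₁) (Γ₂ := Γ₂) (a := a) (b := b) d, g =>
      let r := d.sem (Ctx.exch Γ₁ Γ₂ a b g)
      (r.1, Ctx.exchPerm ι Γ₁ Γ₂ a b ≫ r.2)

end

/-- The element of `♭⟦Q⟧` for a label context `Q`. -/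
def LCtx.pt : (Q : LCtx W) → Ctx.val ι Q.toCtx
  | [] => PUnit.unit
  | _ :: Q => (PUnit.unit, LCtx.pt Q)

/-! ### Configurations -/

/-- `Q ⊢ (C, M) : A; Q'`: the circuit `C : Q → K` has as outputs, up to a permutation, a label
context `L` typing `M` and the label context `Q'`. -/
structure CompConfig {Q K : LCtx W} (C : Circ ι Q K) (M : Comp ι) (A : Ty W) (Q' : LCtx W) where
  dom_nodup : (List.map Prod.fst Q).Nodup
  L : LCtx W
  perm : LPerm K (L ++ Q')
  cod_nodup : (List.map Prod.fst (L ++ Q')).Nodup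
  deriv : CTy L.toCtx M A

/-- `Q ⊢ (C, V) : A; Q'` for a value `V`. -/
structure ValConfig {Q K : LCtx W} (C : Circ ι Q K) (V : Val ι) (A : Ty W) (Q' : LCtx W) where
  dom_nodup : (List.map Prod.fst Q).Nodup
  L : LCtx W
  perm : LPerm K (L ++ Q')
  cod_nodup : (List.map Prod.fst (L ++ Q')).Nodup
  deriv : VTy L.toCtx V A

/-- `⟦(C, M)⟧ = J(id, C); (⟦M⟧ ⋉ Q')`, a morphism `(1, ⟦Q⟧) → (♭⟦A⟧, ♯⟦A⟧ ⊗ ⟦Q'⟧)` of the Kleisli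
category; `C` is post-composed with the permutation to `L, Q'`. -/
def CompConfig.sem {Q K : LCtx W} {C : Circ ι Q K} {M : Comp ι} {A : Ty W} {Q' : LCtx W}
    (c : CompConfig C M A Q') :
    KHom PUnit.{v + 1} (obs ι Q.wires) (A.val ι) (obs ι (A.wires ++ Q'.wires)) :=
  KHom.comp (U := obs ι (c.L.toCtx.wires ++ Q'.wires))
    (J (fun _ => LCtx.pt c.L, C ≫ c.perm.perm ι ≫
      same ι (by rw [LCtx.wires_append, LCtx.wires_toCtx])))
    (fun g => ((c.deriv.sem g).1, padR (c.deriv.sem g).2 Q'.wires))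

/-- `⟦(C, V)⟧`, a morphism `(1, ⟦Q⟧) → (♭⟦A⟧, ♯⟦A⟧ ⊗ ⟦Q'⟧)` of `Set × 𝓜`. -/
def ValConfig.sem {Q K : LCtx W} {C : Circ ι Q K} {V : Val ι} {A : Ty W} {Q' : LCtx W}
    (c : ValConfig C V A Q') :
    VHom PUnit.{v + 1} (obs ι Q.wires) (A.val ι) (obs ι (A.wires ++ Q'.wires)) :=
  (fun _ => c.deriv.sem (LCtx.pt c.L), C ≫ c.perm.perm ι ≫
    same ι (by rw [LCtx.wires_append, ← c.deriv.wires_eq, LCtx.wires_toCtx]))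

end Semantics

end PQC

/-!
Adequacy is proved by a logical relation between closed values and elements of `♭⟦A⟧`.  A value
owns the labels it contains, and a computation realizes a circuit morphism `c` if, started after
any circuit whose outputs are its own labels and a frame `R`, it evaluates to a realizing value and
extends the circuit by `c ⋉ R`.  Quantifying over the frame replaces the interchange law: the wires
not touched by a computation are those of its frame.  Every typed term realizes its denotation, so
`(C, M)` evaluates to some `(D', V')`.  At a ground type a realizing value is determined by its
denotation and owns no labels, so the equation `⟦(C, M)⟧ = J ⟦(D, V)⟧` forces `V' = V` and
`D' = D`.
-/

namespace PQC

open StrictSymmPremonoidal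

variable {W : Type w} {𝓜 : Type u} [StrictSymmPremonoidal.{v} 𝓜] {ι : W → 𝓜}

/-! ### Circuits on sequences of wires -/

theorem wL_eqToHom (X : 𝓜) {Y Z : 𝓜} (h : Y = Z) :
    wL X (eqToHom h) = eqToHom (congrArg (X * ·) h) := by
  subst h; exact wL_id _ _

theorem wR_eqToHom {Y Z : 𝓜} (h : Y = Z) (X : 𝓜) :
    wR (eqToHom h) X = eqToHom (congrArg (· * X) h) := by
  subst h; exact wR_id _ _

theorem wL_congr {X X' : 𝓜} (h : X = X') {Y Z : 𝓜} (f : Y ⟶ Z) :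
    wL X f = eqToHom (by rw [h]) ≫ wL X' f ≫ eqToHom (by rw [h]) := by
  subst h; simp

theorem wR_congr {Y Z : 𝓜} (f : Y ⟶ Z) {X X' : 𝓜} (h : X = X') :
    wR f X = eqToHom (by rw [h]) ≫ wR f X' ≫ eqToHom (by rw [h]) := by
  subst h; simp

theorem symm_congr {X X' Y Y' : 𝓜} (hX : X = X') (hY : Y = Y') :
    symm X Y = eqToHom (by rw [hX, hY]) ≫ symm X' Y' ≫ eqToHom (by rw [hX, hY]) := by
  subst hX hY; simp

theorem wL_one {Y Z : 𝓜} (f : Y ⟶ Z) :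
    wL 1 f = eqToHom (one_mul Y) ≫ f ≫ eqToHom (one_mul Z).symm :=
  (conj_eqToHom_iff_heq _ _ (one_mul Y) (one_mul Z)).mpr (wL_unit f)

theorem wR_one {Y Z : 𝓜} (f : Y ⟶ Z) :
    wR f 1 = eqToHom (mul_one Y) ≫ f ≫ eqToHom (mul_one Z).symm :=
  (conj_eqToHom_iff_heq _ _ (mul_one Y) (mul_one Z)).mpr (wR_unit f)

theorem wL_mul (X X' : 𝓜) {Y Z : 𝓜} (f : Y ⟶ Z) : wL (X * X') f =
    eqToHom (mul_assoc X X' Y) ≫ wL X (wL X' f) ≫ eqToHom (mul_assoc X X' Z).symm :=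
  (conj_eqToHom_iff_heq _ _ (mul_assoc X X' Y) (mul_assoc X X' Z)).mpr (wL_tensor X X' f)

theorem wR_mul {Y Z : 𝓜} (f : Y ⟶ Z) (X X' : 𝓜) : wR f (X * X') =
    eqToHom (mul_assoc Y X X').symm ≫ wR (wR f X) X' ≫ eqToHom (mul_assoc Z X X') :=
  (conj_eqToHom_iff_heq _ _ (mul_assoc Y X X').symm (mul_assoc Z X X').symm).mpr
    (wR_tensor f X X')

theorem wL_wR_assoc (X : 𝓜) {Y Z : 𝓜} (f : Y ⟶ Z) (X' : 𝓜) : wL X (wR f X') =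
    eqToHom (mul_assoc X Y X').symm ≫ wR (wL X f) X' ≫ eqToHom (mul_assoc X Z X') :=
  (conj_eqToHom_iff_heq _ _ (mul_assoc X Y X').symm (mul_assoc X Z X').symm).mpr (wL_wR X f X')

theorem symm_one_right (X : 𝓜) : symm X 1 = eqToHom (by rw [mul_one, one_mul]) := by
  have square : symm X 1 ≫ eqToHom (by rw [mul_one, one_mul]) ≫ symm X 1 = symm X 1 := by
    refine Eq.trans ?_ (symm_congr rfl (one_mul (1 : 𝓜)).symm).symm
    rw [hexagon, wR_one, wL_one]
    simp [-eqToHom_naturality, -eqToHom_naturality_assoc]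
  have cancel := congrArg (symm 1 X ≫ ·) square
  simp only [reassoc_of% (symm_symm 1 X), symm_symm] at cancel
  have h := congrArg (eqToHom (show X * 1 = 1 * X by rw [mul_one, one_mul]) ≫ ·) cancel
  simpa using h

theorem symm_one_left (X : 𝓜) : symm 1 X = eqToHom (by rw [mul_one, one_mul]) := by
  have h := symm_symm (1 : 𝓜) X
  rw [symm_one_right] at h
  have h' := congrArg (· ≫ eqToHom (show 1 * X = X * 1 by rw [mul_one, one_mul])) h
  simpa using h'

theorem hexagon_left (X Y Z : 𝓜) : symm (X * Y) Z =
    eqToHom (mul_assoc X Y Z) ≫ wL X (symm Y Z) ≫ eqToHom (mul_assoc X Z Y).symm ≫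
      wR (symm X Z) Y ≫ eqToHom (mul_assoc Z X Y) := by
  have inverse : symm Z (X * Y) ≫ (eqToHom (mul_assoc X Y Z) ≫ wL X (symm Y Z) ≫
      eqToHom (mul_assoc X Z Y).symm ≫ wR (symm X Z) Y ≫ eqToHom (mul_assoc Z X Y)) = 𝟙 _ := by
    have hL : wL X (symm Z Y) ≫ wL X (symm Y Z) = 𝟙 _ := by rw [← wL_comp, symm_symm, wL_id]
    have hR : wR (symm Z X) Y ≫ wR (symm X Z) Y = 𝟙 _ := by rw [← wR_comp, symm_symm, wR_id]
    simp [hexagon, reassoc_of% hL, reassoc_of% hR]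
  calc symm (X * Y) Z = symm (X * Y) Z ≫ 𝟙 _ := (Category.comp_id _).symm
    _ = _ := by rw [← inverse, reassoc_of% (symm_symm (X * Y) Z)]

theorem same_rfl (l : List W) : same ι (rfl : l = l) = 𝟙 _ := rfl

theorem same_comp_same {l m n : List W} (h : l = m) (h' : m = n) :
    same ι h ≫ same ι h' = same ι (h.trans h') :=
  eqToHom_trans _ _

theorem same_comp_same_assoc {l m n k : List W} (h : l = m) (h' : m = n)
    (f : obs ι n ⟶ obs ι k) : same ι h ≫ same ι h' ≫ f = same ι (h.trans h') ≫ f :=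
  eqToHom_trans_assoc _ _ _

theorem padL_comp {l l' l'' : List W} (m : List W) (f : obs ι l ⟶ obs ι l')
    (g : obs ι l' ⟶ obs ι l'') : padL m (f ≫ g) = padL m f ≫ padL m g := by
  simp [padL, wL_comp]

theorem padR_comp {l l' l'' : List W} (f : obs ι l ⟶ obs ι l') (g : obs ι l' ⟶ obs ι l'')
    (m : List W) : padR (f ≫ g) m = padR f m ≫ padR g m := by
  simp [padR, wR_comp]

theorem padL_id (m l : List W) : padL m (𝟙 (obs ι l)) = 𝟙 _ := by
  simp [padL, wL_id]

theorem padR_id (l m : List W) : padR (𝟙 (obs ι l)) m = 𝟙 _ := by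
  simp [padR, wR_id]

theorem padL_same {l l' : List W} (m : List W) (h : l = l') :
    padL m (same ι h) = same ι (congrArg (m ++ ·) h) := by
  subst h; exact padL_id _ _

theorem padR_same {l l' : List W} (h : l = l') (m : List W) :
    padR (same ι h) m = same ι (congrArg (· ++ m) h) := by
  subst h; exact padR_id _ _

theorem padL_congr {m m' : List W} (h : m = m') {l l' : List W} (f : obs ι l ⟶ obs ι l') :
    padL m f = same ι (by rw [h]) ≫ padL m' f ≫ same ι (by rw [h]) := by
  subst h; simp [same]

theorem padR_congr {l l' : List W} (f : obs ι l ⟶ obs ι l') {m m' : List W} (h : m = m') :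
    padR f m = same ι (by rw [h]) ≫ padR f m' ≫ same ι (by rw [h]) := by
  subst h; simp [same]

theorem swapBlocks_congr {l l' m m' : List W} (h : l = l') (h' : m = m') : swapBlocks ι l m =
    same ι (by rw [h, h']) ≫ swapBlocks ι l' m' ≫ same ι (by rw [h, h']) := by
  subst h h'; simp [same]

theorem padL_nil {l l' : List W} (f : obs ι l ⟶ obs ι l') : padL [] f = f := by
  rw [padL, wL_congr (show obs ι [] = 1 from rfl), wL_one]
  simp

theorem padR_nil {l l' : List W} (f : obs ι l ⟶ obs ι l') : padR f [] =
    same ι (List.append_nil l) ≫ f ≫ same ι (List.append_nil l').symm := by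
  rw [padR, wR_congr f (show obs ι [] = 1 from rfl), wR_one]
  simp [same]

theorem padL_append (m m' : List W) {l l' : List W} (f : obs ι l ⟶ obs ι l') :
    padL (m ++ m') f = same ι (List.append_assoc ..) ≫ padL m (padL m' f) ≫
      same ι (List.append_assoc ..).symm := by
  rw [padL, wL_congr (obs_append ι m m') f, wL_mul]
  simp [padL, same, wL_comp, wL_eqToHom]

theorem padR_append {l l' : List W} (f : obs ι l ⟶ obs ι l') (m m' : List W) :
    padR f (m ++ m') = same ι (List.append_assoc ..).symm ≫ padR (padR f m) m' ≫
      same ι (List.append_assoc ..) := by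
  rw [padR, wR_congr f (obs_append ι m m'), wR_mul]
  simp [padR, same, wR_comp, wR_eqToHom]

theorem padL_padR (m : List W) {l l' : List W} (f : obs ι l ⟶ obs ι l') (m' : List W) :
    padL m (padR f m') = same ι (List.append_assoc ..).symm ≫ padR (padL m f) m' ≫
      same ι (List.append_assoc ..) := by
  simp [padL, padR, same, wL_comp, wL_eqToHom, wR_comp, wR_eqToHom, wL_wR_assoc]

theorem swapBlocks_swapBlocks (l m : List W) :
    swapBlocks ι l m ≫ swapBlocks ι m l = 𝟙 _ := by
  simp [swapBlocks, reassoc_of% (symm_symm (obs ι l) (obs ι m))]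

theorem padR_swapBlocks {l l' : List W} (f : obs ι l ⟶ obs ι l') (m : List W) :
    padR f m ≫ swapBlocks ι l' m = swapBlocks ι l m ≫ padL m f := by
  simp [padR, padL, swapBlocks, reassoc_of% (symm_natural_left f (obs ι m))]

theorem padL_eq_swapBlocks_padR (m : List W) {l l' : List W} (f : obs ι l ⟶ obs ι l') :
    padL m f = swapBlocks ι m l ≫ padR f m ≫ swapBlocks ι l' m := by
  rw [padR_swapBlocks, ← Category.assoc, swapBlocks_swapBlocks, Category.id_comp]

theorem swapBlocks_nil_right (l : List W) : swapBlocks ι l [] = same ι (List.append_nil l) := by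
  have h : symm (obs ι l) (obs ι []) = eqToHom (by simp [obs]) := symm_one_right (obs ι l)
  simp [swapBlocks, h, same]

theorem swapBlocks_nil_left (l : List W) :
    swapBlocks ι [] l = same ι (List.append_nil l).symm := by
  have h : symm (obs ι []) (obs ι l) = eqToHom (by simp [obs]) := symm_one_left (obs ι l)
  simp [swapBlocks, h, same]

theorem swapBlocks_append_right (l m n : List W) : swapBlocks ι l (m ++ n) =
    same ι (List.append_assoc ..).symm ≫ padR (swapBlocks ι l m) n ≫
      same ι (List.append_assoc ..) ≫ padL m (swapBlocks ι l n) ≫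
        same ι (List.append_assoc ..).symm := by
  rw [swapBlocks, symm_congr rfl (obs_append ι m n), hexagon]
  simp [padL, padR, swapBlocks, same, wL_comp, wL_eqToHom, wR_comp, wR_eqToHom]

theorem swapBlocks_append_left (l m n : List W) : swapBlocks ι (l ++ m) n =
    same ι (List.append_assoc ..) ≫ padL l (swapBlocks ι m n) ≫
      same ι (List.append_assoc ..).symm ≫ padR (swapBlocks ι l n) m ≫
        same ι (List.append_assoc ..) := by
  rw [swapBlocks, symm_congr (obs_append ι l m) rfl, hexagon_left]
  simp [padL, padR, swapBlocks, same, wL_comp, wL_eqToHom, wR_comp, wR_eqToHom]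

/-! ### Permutations of label contexts -/

/-- The labels of `Q` are pairwise distinct. -/
abbrev LCtx.Distinct (Q : LCtx W) : Prop := (List.map Prod.fst Q).Nodup

theorem LCtx.Distinct.of_append_left {Q R : LCtx W} (h : LCtx.Distinct (Q ++ R)) : Q.Distinct := by
  rw [LCtx.Distinct, List.map_append] at h
  exact h.of_append_left

theorem LCtx.Distinct.of_append_right {Q R : LCtx W} (h : LCtx.Distinct (Q ++ R)) : R.Distinct := by
  rw [LCtx.Distinct, List.map_append] at h
  exact h.of_append_right

namespace LPerm

theorem toPerm {Q R : LCtx W} (σ : LPerm Q R) : List.Perm Q R := by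
  induction σ with
  | nil => exact .nil
  | cons a _ ih => exact .cons a ih
  | swap a b Q => exact .swap b a Q
  | trans _ _ ih₁ ih₂ => exact ih₁.trans ih₂

theorem eq_nil {Q : LCtx W} (σ : LPerm Q []) : Q = [] := σ.toPerm.eq_nil

theorem distinct_iff {Q R : LCtx W} (σ : LPerm Q R) : Q.Distinct ↔ R.Distinct :=
  (σ.toPerm.map Prod.fst).nodup_iff

/-- The identity permutation. -/
def refl : (Q : LCtx W) → LPerm Q Q
  | [] => .nil
  | a :: Q => .cons a (refl Q)

theorem perm_refl : (Q : LCtx W) → (refl Q).perm ι = 𝟙 _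
  | [] => rfl
  | a :: Q => by rw [refl, perm, perm_refl Q]; exact padL_id _ _

/-- The identity permutation between equal label contexts. -/
def ofEq {Q R : LCtx W} (h : Q = R) : LPerm Q R := h ▸ refl Q

theorem perm_ofEq {Q R : LCtx W} (h : Q = R) :
    (ofEq h).perm ι = same ι (congrArg LCtx.wires h) := by
  subst h; exact perm_refl Q

theorem perm_eq_same {Q : LCtx W} (σ : LPerm Q []) :
    σ.perm ι = same ι (congrArg LCtx.wires σ.eq_nil) := by
  suffices ∀ {Q R : LCtx W} (σ : LPerm Q R), R = [] → ∀ h : Q.wires = R.wires,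
      σ.perm ι = same ι h from this σ rfl _
  intro Q R σ hR h
  induction σ with
  | nil => rfl
  | cons | swap => cases hR
  | trans σ τ ih₁ ih₂ =>
    subst hR
    obtain rfl := τ.eq_nil
    rw [perm, ih₁ rfl h, ih₂ rfl rfl, same_comp_same]

/-- Extend a permutation by the identity on the right. -/
def appendRight : {Q Q' : LCtx W} → LPerm Q Q' → (R : LCtx W) → LPerm (Q ++ R) (Q' ++ R)
  | _, _, .nil, R => refl R
  | _, _, .cons a σ, R => .cons a (σ.appendRight R)
  | _, _, .swap a b Q, R => .swap a b (Q ++ R)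
  | _, _, .trans σ τ, R => .trans (σ.appendRight R) (τ.appendRight R)

theorem perm_appendRight {Q Q' : LCtx W} (σ : LPerm Q Q') (R : LCtx W) :
    (σ.appendRight R).perm ι = same ι (LCtx.wires_append Q R) ≫ padR (σ.perm ι) R.wires ≫
      same ι (LCtx.wires_append Q' R).symm := by
  induction σ with
  | nil =>
    refine (perm_refl R).trans ?_
    rw [perm, padR_id, Category.id_comp, same_comp_same]
    rfl
  | cons a σ ih =>
    rw [appendRight, perm, ih, perm, padL_comp, padL_comp, padL_same, padL_same, padL_padR]
    simp only [Category.assoc, same_comp_same, same_comp_same_assoc]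
  | swap a b Q =>
    rw [appendRight, perm, perm, padR_congr _ (LCtx.wires_append Q R), padR_append]
    simp only [Category.assoc, same_comp_same, same_comp_same_assoc]
  | trans σ τ ih₁ ih₂ =>
    rw [appendRight, perm, ih₁, ih₂, perm, padR_comp]
    simp only [Category.assoc, same_comp_same_assoc, same_rfl, Category.id_comp]

/-- Extend a permutation by the identity on the left. -/
def appendLeft {Q Q' : LCtx W} : (R : LCtx W) → LPerm Q Q' → LPerm (R ++ Q) (R ++ Q')
  | [], σ => σ
  | a :: R, σ => .cons a (appendLeft R σ)

theorem perm_appendLeft {Q Q' : LCtx W} (R : LCtx W) (σ : LPerm Q Q') :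
    (appendLeft R σ).perm ι = same ι (LCtx.wires_append R Q) ≫ padL R.wires (σ.perm ι) ≫
      same ι (LCtx.wires_append R Q').symm := by
  induction R with
  | nil =>
    have h : padL (LCtx.wires ([] : LCtx W)) (σ.perm ι) = σ.perm ι := padL_nil _
    rw [h]
    exact ((Category.id_comp _).trans (Category.comp_id _)).symm
  | cons a R ih =>
    have h : padL (LCtx.wires (a :: R)) (σ.perm ι) = _ :=
      padL_append [a.2] (LCtx.wires R) (σ.perm ι)
    rw [h, appendLeft, perm, ih, padL_comp, padL_comp, padL_same, padL_same]
    simp only [Category.assoc, same_comp_same, same_comp_same_assoc]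

/-- Move the first label to the end. -/
def moveToEnd (a : Label × W) : (Q : LCtx W) → LPerm (a :: Q) (Q ++ [a])
  | [] => refl [a]
  | b :: Q => .trans (.swap a b Q) (.cons b (moveToEnd a Q))

theorem perm_moveToEnd (a : Label × W) (Q : LCtx W) : (moveToEnd a Q).perm ι =
    swapBlocks ι [a.2] Q.wires ≫ same ι (LCtx.wires_append Q [a]).symm := by
  induction Q with
  | nil =>
    have h : swapBlocks ι [a.2] (LCtx.wires ([] : LCtx W)) = _ := swapBlocks_nil_right [a.2]
    rw [moveToEnd, perm_refl, h, same_comp_same]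
    rfl
  | cons b Q ih =>
    have h : swapBlocks ι [a.2] (LCtx.wires (b :: Q)) = _ :=
      swapBlocks_append_right [a.2] [b.2] (LCtx.wires Q)
    rw [moveToEnd, perm, perm, perm, ih, h, padL_comp, padL_same]
    simp only [Category.assoc, same_rfl, Category.id_comp]

/-- Exchange two blocks of labels. -/
def blockSwap : (Q R : LCtx W) → LPerm (Q ++ R) (R ++ Q)
  | [], R => ofEq (List.append_nil R).symm
  | a :: Q, R => .trans (.cons a (blockSwap Q R))
      (.trans ((moveToEnd a R).appendRight Q) (ofEq (List.append_assoc R [a] Q)))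

theorem perm_blockSwap (Q R : LCtx W) : (blockSwap Q R).perm ι =
    same ι (LCtx.wires_append Q R) ≫ swapBlocks ι Q.wires R.wires ≫
      same ι (LCtx.wires_append R Q).symm := by
  induction Q with
  | nil =>
    have h : swapBlocks ι (LCtx.wires ([] : LCtx W)) R.wires = _ := swapBlocks_nil_left R.wires
    rw [blockSwap, perm_ofEq, h, same_comp_same, same_comp_same]
  | cons a Q ih =>
    have h : swapBlocks ι (LCtx.wires (a :: Q)) R.wires = _ :=
      swapBlocks_append_left [a.2] (LCtx.wires Q) R.wires
    rw [blockSwap, perm, perm, perm, ih, h, perm_ofEq, perm_appendRight, perm_moveToEnd,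
      padL_comp, padL_comp, padL_same, padL_same, padR_comp, padR_same]
    simp only [Category.assoc, same_comp_same, same_comp_same_assoc]

/-- Exchange two blocks of labels between `L₁` and `L₂`. -/
def exchBlocks (L₁ M N L₂ : LCtx W) : LPerm (L₁ ++ M ++ N ++ L₂) (L₁ ++ N ++ M ++ L₂) :=
  .trans (ofEq (by simp only [List.append_assoc]))
    (.trans (appendLeft L₁ ((blockSwap M N).appendRight L₂))
      (ofEq (by simp only [List.append_assoc])))

theorem perm_exchBlocks (L₁ M N L₂ : LCtx W) : (exchBlocks L₁ M N L₂).perm ι =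
    same ι (by simp only [LCtx.wires_append, List.append_assoc]) ≫
      padL L₁.wires (padR (swapBlocks ι M.wires N.wires) L₂.wires) ≫
        same ι (by simp only [LCtx.wires_append, List.append_assoc]) := by
  rw [exchBlocks, perm, perm, perm_ofEq, perm_ofEq, perm_appendLeft, perm_appendRight,
    perm_blockSwap]
  simp only [padL_comp, padL_same, padR_comp, padR_same, Category.assoc, same_comp_same,
    same_comp_same_assoc]

/-- Rename the labels of a permutation. -/
def rename (ρ : Label → Label) : {Q R : LCtx W} → LPerm Q R → LPerm (Q.rename ρ) (R.rename ρ)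
  | _, _, .nil => .nil
  | _, _, .cons a σ => .cons (ρ a.1, a.2) (σ.rename ρ)
  | _, _, .swap a b Q => .swap (ρ a.1, a.2) (ρ b.1, b.2) (Q.rename ρ)
  | _, _, .trans σ τ => .trans (σ.rename ρ) (τ.rename ρ)

theorem perm_rename (ρ : Label → Label) {Q R : LCtx W} (σ : LPerm Q R) :
    (σ.rename ρ).perm ι = same ι (LCtx.wires_rename ρ Q) ≫ σ.perm ι ≫
      same ι (LCtx.wires_rename ρ R).symm := by
  induction σ with
  | nil => exact ((Category.id_comp _).trans (Category.comp_id _)).symm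
  | cons a σ ih =>
    refine (congrArg (padL [a.2]) ih).trans ?_
    rw [perm, padL_comp, padL_comp, padL_same, padL_same]
    rfl
  | swap a b Q => exact padR_congr (swapBlocks ι [a.2] [b.2]) (LCtx.wires_rename ρ Q)
  | trans σ τ ih₁ ih₂ =>
    rw [rename, perm, ih₁, ih₂, perm]
    simp only [Category.assoc, same_comp_same_assoc, same_rfl, Category.id_comp]

end LPerm

/-! ### Substitution -/

mutual

/-- Simultaneous substitution of values for the free variables. -/
def Val.subst (γ : ℕ → Val ι) : Val ι → Val ι
  | .unit => .unit
  | .nat n => .nat n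
  | .bvar j => .bvar j
  | .fvar x => γ x
  | .lab l => .lab l
  | .lam A M => .lam A (M.subst γ)
  | .lift M => .lift (M.subst γ)
  | .boxed l C k => .boxed l C k
  | .pair V₁ V₂ => .pair (V₁.subst γ) (V₂.subst γ)

/-- Simultaneous substitution of values for the free variables. -/
def Comp.subst (γ : ℕ → Val ι) : Comp ι → Comp ι
  | .app V₁ V₂ => .app (V₁.subst γ) (V₂.subst γ)
  | .force V => .force (V.subst γ)
  | .box T V => .box T (V.subst γ)
  | .apply V₁ V₂ => .apply (V₁.subst γ) (V₂.subst γ)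
  | .dest V M => .dest (V.subst γ) (M.subst γ)
  | .ifz V M N => .ifz (V.subst γ) (M.subst γ) (N.subst γ)
  | .ret V => .ret (V.subst γ)
  | .letin M N => .letin (M.subst γ) (N.subst γ)

end

mutual

/-- `V` is locally closed at level `k`: its dangling de Bruijn indices are smaller than `k`. -/
def Val.LCAt : ℕ → Val ι → Prop
  | k, .bvar j => j < k
  | k, .lam _ M => M.LCAt (k + 1)
  | k, .lift M => M.LCAt k
  | k, .pair V₁ V₂ => V₁.LCAt k ∧ V₂.LCAt k
  | _, .unit | _, .nat _ | _, .fvar _ | _, .lab _ | _, .boxed _ _ _ => True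

/-- `M` is locally closed at level `k`: its dangling de Bruijn indices are smaller than `k`. -/
def Comp.LCAt : ℕ → Comp ι → Prop
  | k, .app V₁ V₂ => V₁.LCAt k ∧ V₂.LCAt k
  | k, .force V => V.LCAt k
  | k, .box _ V => V.LCAt k
  | k, .apply V₁ V₂ => V₁.LCAt k ∧ V₂.LCAt k
  | k, .dest V M => V.LCAt k ∧ M.LCAt (k + 2)
  | k, .ifz V M N => V.LCAt k ∧ M.LCAt k ∧ N.LCAt k
  | k, .ret V => V.LCAt k
  | k, .letin M N => M.LCAt k ∧ N.LCAt (k + 1)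

end

mutual

theorem Val.LCAt.mono {k k' : ℕ} (hk : k ≤ k') : ∀ {V : Val ι}, V.LCAt k → V.LCAt k'
  | .bvar _, h => lt_of_lt_of_le (show _ < k from h) hk
  | .lam _ M, h => Comp.LCAt.mono (Nat.succ_le_succ hk) (M := M) h
  | .lift M, h => Comp.LCAt.mono hk (M := M) h
  | .pair _ _, h => ⟨h.1.mono hk, h.2.mono hk⟩
  | .unit, _ | .nat _, _ | .fvar _, _ | .lab _, _ | .boxed _ _ _, _ => trivial

theorem Comp.LCAt.mono {k k' : ℕ} (hk : k ≤ k') : ∀ {M : Comp ι}, M.LCAt k → M.LCAt k'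
  | .app _ _, h => ⟨h.1.mono hk, h.2.mono hk⟩
  | .force V, h => Val.LCAt.mono hk (V := V) h
  | .box _ V, h => Val.LCAt.mono hk (V := V) h
  | .apply _ _, h => ⟨h.1.mono hk, h.2.mono hk⟩
  | .dest _ _, h => ⟨h.1.mono hk, h.2.mono (Nat.add_le_add_right hk 2)⟩
  | .ifz _ _ _, h => ⟨h.1.mono hk, h.2.1.mono hk, h.2.2.mono hk⟩
  | .ret V, h => Val.LCAt.mono hk (V := V) h
  | .letin _ _, h => ⟨h.1.mono hk, h.2.mono (Nat.succ_le_succ hk)⟩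

end

mutual

theorem Val.opn_eq_self (X : Val ι) : ∀ {V : Val ι} {i : ℕ}, V.LCAt i → Val.opn X i V = V
  | .bvar j, i, h => if_neg (show j < i from h).ne
  | .lam A M, _, h => congrArg (Val.lam A) (Comp.opn_eq_self X (M := M) h)
  | .lift M, _, h => congrArg Val.lift (Comp.opn_eq_self X (M := M) h)
  | .pair _ _, _, h => congrArg₂ Val.pair (Val.opn_eq_self X h.1) (Val.opn_eq_self X h.2)
  | .unit, _, _ | .nat _, _, _ | .fvar _, _, _ | .lab _, _, _ | .boxed _ _ _, _, _ => rfl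

theorem Comp.opn_eq_self (X : Val ι) : ∀ {M : Comp ι} {i : ℕ}, M.LCAt i → M.opn X i = M
  | .app _ _, _, h => congrArg₂ Comp.app (Val.opn_eq_self X h.1) (Val.opn_eq_self X h.2)
  | .force V, _, h => congrArg Comp.force (Val.opn_eq_self X (V := V) h)
  | .box T V, _, h => congrArg (Comp.box T) (Val.opn_eq_self X (V := V) h)
  | .apply _ _, _, h => congrArg₂ Comp.apply (Val.opn_eq_self X h.1) (Val.opn_eq_self X h.2)
  | .dest _ _, _, h => congrArg₂ Comp.dest (Val.opn_eq_self X h.1) (Comp.opn_eq_self X h.2)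
  | .ifz _ _ _, _, h => by
    rw [Comp.opn, Val.opn_eq_self X h.1, Comp.opn_eq_self X h.2.1, Comp.opn_eq_self X h.2.2]
  | .ret V, _, h => congrArg Comp.ret (Val.opn_eq_self X (V := V) h)
  | .letin _ _, _, h => congrArg₂ Comp.letin (Comp.opn_eq_self X h.1) (Comp.opn_eq_self X h.2)

end

mutual

theorem Val.LCAt.of_opn {X : Val ι} : ∀ {V : Val ι} {k : ℕ}, (Val.opn X k V).LCAt k → V.LCAt (k + 1)
  | .bvar j, k, h => by
    rcases eq_or_ne j k with rfl | hj
    · exact Nat.lt_succ_self j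
    · rw [Val.opn, if_neg hj] at h
      exact Nat.lt_succ_of_lt h
  | .lam _ M, _, h => Comp.LCAt.of_opn (M := M) h
  | .lift M, _, h => Comp.LCAt.of_opn (M := M) h
  | .pair _ _, _, h => ⟨Val.LCAt.of_opn h.1, Val.LCAt.of_opn h.2⟩
  | .unit, _, _ | .nat _, _, _ | .fvar _, _, _ | .lab _, _, _ | .boxed _ _ _, _, _ => trivial

theorem Comp.LCAt.of_opn {X : Val ι} :
    ∀ {M : Comp ι} {k : ℕ}, (M.opn X k).LCAt k → M.LCAt (k + 1)
  | .app _ _, _, h => ⟨Val.LCAt.of_opn h.1, Val.LCAt.of_opn h.2⟩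
  | .force V, _, h => Val.LCAt.of_opn (V := V) h
  | .box _ V, _, h => Val.LCAt.of_opn (V := V) h
  | .apply _ _, _, h => ⟨Val.LCAt.of_opn h.1, Val.LCAt.of_opn h.2⟩
  | .dest _ _, _, h => ⟨Val.LCAt.of_opn h.1, Comp.LCAt.of_opn h.2⟩
  | .ifz _ _ _, _, h =>
    ⟨Val.LCAt.of_opn h.1, Comp.LCAt.of_opn h.2.1, Comp.LCAt.of_opn h.2.2⟩
  | .ret V, _, h => Val.LCAt.of_opn (V := V) h
  | .letin _ _, _, h => ⟨Comp.LCAt.of_opn h.1, Comp.LCAt.of_opn h.2⟩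

end

mutual

theorem Val.LCAt.subst {γ : ℕ → Val ι} (hγ : ∀ x, (γ x).LCAt 0) :
    ∀ {V : Val ι} {k : ℕ}, V.LCAt k → (V.subst γ).LCAt k
  | .fvar x, k, _ => (hγ x).mono (Nat.zero_le k)
  | .bvar _, _, h => h
  | .lam _ M, _, h => Comp.LCAt.subst hγ (M := M) h
  | .lift M, _, h => Comp.LCAt.subst hγ (M := M) h
  | .pair _ _, _, h => ⟨h.1.subst hγ, h.2.subst hγ⟩
  | .unit, _, _ | .nat _, _, _ | .lab _, _, _ | .boxed _ _ _, _, _ => trivial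

theorem Comp.LCAt.subst {γ : ℕ → Val ι} (hγ : ∀ x, (γ x).LCAt 0) :
    ∀ {M : Comp ι} {k : ℕ}, M.LCAt k → (M.subst γ).LCAt k
  | .app _ _, _, h => ⟨h.1.subst hγ, h.2.subst hγ⟩
  | .force V, _, h => Val.LCAt.subst hγ (V := V) h
  | .box _ V, _, h => Val.LCAt.subst hγ (V := V) h
  | .apply _ _, _, h => ⟨h.1.subst hγ, h.2.subst hγ⟩
  | .dest _ _, _, h => ⟨h.1.subst hγ, h.2.subst hγ⟩
  | .ifz _ _ _, _, h => ⟨h.1.subst hγ, h.2.1.subst hγ, h.2.2.subst hγ⟩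
  | .ret V, _, h => Val.LCAt.subst hγ (V := V) h
  | .letin _ _, _, h => ⟨h.1.subst hγ, h.2.subst hγ⟩

end

mutual

theorem Val.subst_opn {γ : ℕ → Val ι} (hγ : ∀ x, (γ x).LCAt 0) (X : Val ι) :
    ∀ (V : Val ι) (i : ℕ), (Val.opn X i V).subst γ = Val.opn (X.subst γ) i (V.subst γ)
  | .bvar j, i => apply_ite (Val.subst γ) (j = i) X (.bvar j)
  | .fvar x, i => (Val.opn_eq_self _ ((hγ x).mono (Nat.zero_le i))).symm
  | .lam A M, i => congrArg (Val.lam A) (Comp.subst_opn hγ X M (i + 1))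
  | .lift M, i => congrArg Val.lift (Comp.subst_opn hγ X M i)
  | .pair V₁ V₂, i => congrArg₂ Val.pair (Val.subst_opn hγ X V₁ i) (Val.subst_opn hγ X V₂ i)
  | .unit, _ | .nat _, _ | .lab _, _ | .boxed _ _ _, _ => rfl

theorem Comp.subst_opn {γ : ℕ → Val ι} (hγ : ∀ x, (γ x).LCAt 0) (X : Val ι) :
    ∀ (M : Comp ι) (i : ℕ), (M.opn X i).subst γ = (M.subst γ).opn (X.subst γ) i
  | .app V₁ V₂, i => congrArg₂ Comp.app (Val.subst_opn hγ X V₁ i) (Val.subst_opn hγ X V₂ i)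
  | .force V, i => congrArg Comp.force (Val.subst_opn hγ X V i)
  | .box T V, i => congrArg (Comp.box T) (Val.subst_opn hγ X V i)
  | .apply V₁ V₂, i => congrArg₂ Comp.apply (Val.subst_opn hγ X V₁ i) (Val.subst_opn hγ X V₂ i)
  | .dest V M, i => congrArg₂ Comp.dest (Val.subst_opn hγ X V i) (Comp.subst_opn hγ X M (i + 2))
  | .ifz V M N, i => by
    simp only [Comp.opn, Comp.subst, Val.subst_opn hγ X V, Comp.subst_opn hγ X M,
      Comp.subst_opn hγ X N]
  | .ret V, i => congrArg Comp.ret (Val.subst_opn hγ X V i)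
  | .letin M N, i =>
    congrArg₂ Comp.letin (Comp.subst_opn hγ X M i) (Comp.subst_opn hγ X N (i + 1))

end

mutual

theorem Val.subst_congr {γ γ' : ℕ → Val ι} :
    ∀ {V : Val ι}, (∀ x ∈ V.fv, γ x = γ' x) → V.subst γ = V.subst γ'
  | .fvar x, h => h x (Finset.mem_singleton_self x)
  | .lam A M, h => congrArg (Val.lam A) (Comp.subst_congr (M := M) h)
  | .lift M, h => congrArg Val.lift (Comp.subst_congr (M := M) h)
  | .pair V₁ V₂, h => by
    simp only [Val.fv, Finset.forall_mem_union] at h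
    rw [Val.subst, Val.subst_congr h.1, Val.subst_congr h.2, Val.subst]
  | .unit, _ | .nat _, _ | .bvar _, _ | .lab _, _ | .boxed _ _ _, _ => rfl

theorem Comp.subst_congr {γ γ' : ℕ → Val ι} :
    ∀ {M : Comp ι}, (∀ x ∈ M.fv, γ x = γ' x) → M.subst γ = M.subst γ'
  | .app V₁ V₂, h => by
    simp only [Comp.fv, Finset.forall_mem_union] at h
    rw [Comp.subst, Val.subst_congr h.1, Val.subst_congr h.2, Comp.subst]
  | .force V, h => congrArg Comp.force (Val.subst_congr (V := V) h)
  | .box T V, h => congrArg (Comp.box T) (Val.subst_congr (V := V) h)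
  | .apply V₁ V₂, h => by
    simp only [Comp.fv, Finset.forall_mem_union] at h
    rw [Comp.subst, Val.subst_congr h.1, Val.subst_congr h.2, Comp.subst]
  | .dest V M, h => by
    simp only [Comp.fv, Finset.forall_mem_union] at h
    rw [Comp.subst, Val.subst_congr h.1, Comp.subst_congr h.2, Comp.subst]
  | .ifz V M N, h => by
    simp only [Comp.fv, Finset.forall_mem_union] at h
    rw [Comp.subst, Val.subst_congr h.1.1, Comp.subst_congr h.1.2, Comp.subst_congr h.2,
      Comp.subst]
  | .ret V, h => congrArg Comp.ret (Val.subst_congr (V := V) h)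
  | .letin M N, h => by
    simp only [Comp.fv, Finset.forall_mem_union] at h
    rw [Comp.subst, Comp.subst_congr h.1, Comp.subst_congr h.2, Comp.subst]

end

mutual

theorem Val.subst_fvar : ∀ V : Val ι, V.subst .fvar = V
  | .lam A M => congrArg (Val.lam A) (Comp.subst_fvar M)
  | .lift M => congrArg Val.lift (Comp.subst_fvar M)
  | .pair V₁ V₂ => congrArg₂ Val.pair (Val.subst_fvar V₁) (Val.subst_fvar V₂)
  | .unit | .nat _ | .bvar _ | .fvar _ | .lab _ | .boxed _ _ _ => rfl

theorem Comp.subst_fvar : ∀ M : Comp ι, M.subst .fvar = M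
  | .app V₁ V₂ => congrArg₂ Comp.app (Val.subst_fvar V₁) (Val.subst_fvar V₂)
  | .force V => congrArg Comp.force (Val.subst_fvar V)
  | .box T V => congrArg (Comp.box T) (Val.subst_fvar V)
  | .apply V₁ V₂ => congrArg₂ Comp.apply (Val.subst_fvar V₁) (Val.subst_fvar V₂)
  | .dest V M => congrArg₂ Comp.dest (Val.subst_fvar V) (Comp.subst_fvar M)
  | .ifz V M N => by rw [Comp.subst, Val.subst_fvar V, Comp.subst_fvar M, Comp.subst_fvar N]
  | .ret V => congrArg Comp.ret (Val.subst_fvar V)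
  | .letin M N => congrArg₂ Comp.letin (Comp.subst_fvar M) (Comp.subst_fvar N)

end

theorem Val.LCAt.update {γ : ℕ → Val ι} (hγ : ∀ x, (γ x).LCAt 0) {X : Val ι} (hX : X.LCAt 0)
    (x y : ℕ) : (Function.update γ x X y).LCAt 0 := by
  rcases eq_or_ne y x with rfl | hy
  · rwa [Function.update_self]
  · rw [Function.update_of_ne hy]
    exact hγ y

theorem Comp.subst_update_of_notMem {x : ℕ} {M : Comp ι} (hx : x ∉ M.fv) (γ : ℕ → Val ι)
    (X : Val ι) : M.subst (Function.update γ x X) = M.subst γ :=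
  Comp.subst_congr fun _ hy => Function.update_of_ne (ne_of_mem_of_not_mem hy hx) _ _

theorem Comp.subst_update_opn {γ : ℕ → Val ι} (hγ : ∀ x, (γ x).LCAt 0) {X : Val ι}
    (hX : X.LCAt 0) {x : ℕ} {M : Comp ι} (hx : x ∉ M.fv) :
    (M.opn (.fvar x) 0).subst (Function.update γ x X) = (M.subst γ).opn X 0 := by
  rw [Comp.subst_opn (Val.LCAt.update hγ hX x), Comp.subst_update_of_notMem hx, Val.subst,
    Function.update_self]

theorem Comp.subst_update_opn₂ {γ : ℕ → Val ι} (hγ : ∀ x, (γ x).LCAt 0) {X Y : Val ι}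
    (hX : X.LCAt 0) (hY : Y.LCAt 0) {x y : ℕ} (hxy : x ≠ y) {M : Comp ι} (hx : x ∉ M.fv)
    (hy : y ∉ M.fv) :
    ((M.opn (.fvar x) 1).opn (.fvar y) 0).subst
      (Function.update (Function.update γ x X) y Y) = ((M.subst γ).opn X 1).opn Y 0 := by
  have hγ' := Val.LCAt.update (Val.LCAt.update hγ hX x) hY y
  rw [Comp.subst_opn hγ', Comp.subst_opn hγ', Comp.subst_update_of_notMem hy,
    Comp.subst_update_of_notMem hx, Val.subst, Val.subst, Function.update_self,
    Function.update_of_ne hxy, Function.update_self]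

theorem Bundle.subst_toVal (γ : ℕ → Val ι) : ∀ b : Bundle, (b.toVal (ι := ι)).subst γ = b.toVal
  | .unit | .lab _ => rfl
  | .pair a b => congrArg₂ Val.pair (a.subst_toVal γ) (b.subst_toVal γ)

theorem Bundle.toVal_injective : ∀ {a b : Bundle}, a.toVal (ι := ι) = b.toVal → a = b
  | .unit, .unit, _ => rfl
  | .lab _, .lab _, h => congrArg Bundle.lab (Val.lab.inj h)
  | .pair _ _, .pair _ _, h =>
    congrArg₂ Bundle.pair (Bundle.toVal_injective (Val.pair.inj h).1)
      (Bundle.toVal_injective (Val.pair.inj h).2)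

mutual

theorem VTy.lcAt_zero {Γ : Ctx W} {V : Val ι} {A : Ty W} : VTy Γ V A → V.LCAt 0
  | .abs _ _ d => d.lcAt_zero.of_opn
  | .lift _ d => d.lcAt_zero
  | .pair _ _ d₁ d₂ => ⟨d₁.lcAt_zero, d₂.lcAt_zero⟩
  | .unit _ _ | .nat _ _ _ | .lab _ _ _ _ | .var _ _ _ _ | .circ _ _ _ _ _ _ _ => trivial

theorem CTy.lcAt_zero {Γ : Ctx W} {M : Comp ι} {A : Ty W} : CTy Γ M A → M.LCAt 0
  | .app _ _ d₁ d₂ => ⟨d₁.lcAt_zero, d₂.lcAt_zero⟩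
  | .force _ d => d.lcAt_zero
  | .box _ d => d.lcAt_zero
  | .apply _ _ d₁ d₂ => ⟨d₁.lcAt_zero, d₂.lcAt_zero⟩
  | .dest _ _ _ _ _ _ d₁ d₂ => ⟨d₁.lcAt_zero, d₂.lcAt_zero.of_opn.of_opn⟩
  | .ifz _ d d₁ d₂ => ⟨d.lcAt_zero, d₁.lcAt_zero, d₂.lcAt_zero⟩
  | .ret d => d.lcAt_zero
  | .letin _ _ _ _ d₁ d₂ => ⟨d₁.lcAt_zero, d₂.lcAt_zero.of_opn⟩
  | .ex d => d.lcAt_zero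

end

theorem Ctx.WF.left {Γ Δ : Ctx W} (h : Ctx.WF (Γ ++ Δ)) : Γ.WF := by
  rw [Ctx.WF, List.map_append] at h
  exact h.of_append_left

theorem Ctx.WF.right {Γ Δ : Ctx W} (h : Ctx.WF (Γ ++ Δ)) : Δ.WF := by
  rw [Ctx.WF, List.map_append] at h
  exact h.of_append_right

theorem Ctx.WF.name_notMem_left {Γ Δ : Ctx W} (h : Ctx.WF (Γ ++ Δ)) {e : Entry W} (he : e ∈ Δ) :
    e.name ∉ List.map Entry.name Γ := by
  rw [Ctx.WF, List.map_append] at h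
  exact fun he' => List.disjoint_of_nodup_append h he' (List.mem_map_of_mem he)

theorem Ctx.WF.perm {Γ Δ : Ctx W} (h : Γ.WF) (p : Γ.Perm Δ) : Δ.WF :=
  (p.map Entry.name).nodup h

mutual

theorem VTy.wf {Γ : Ctx W} {V : Val ι} {A : Ty W} : VTy Γ V A → Γ.WF
  | .unit _ hn | .nat _ hn _ | .lab _ _ _ hn | .var _ _ _ hn | .circ _ hn _ _ _ _ _
  | .pair _ hn _ _ => hn
  | .abs _ _ d => d.wf.left
  | .lift _ d => d.wf

theorem CTy.wf {Γ : Ctx W} {M : Comp ι} {A : Ty W} : CTy Γ M A → Γ.WF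
  | .app _ hn _ _ | .apply _ hn _ _ | .dest _ hn _ _ _ _ _ _ | .letin _ hn _ _ _ _ => hn
  | .force _ d => d.wf
  | .box _ d => d.wf
  | .ifz _ _ d₁ _ => d₁.wf
  | .ret d => d.wf
  | .ex (Γ₁ := Γ₁) d => d.wf.perm <| by
    simp only [List.append_assoc, List.singleton_append]
    exact (List.Perm.swap _ _ _).append_left Γ₁

end

/-! ### Interfaces of boxed circuits -/

theorem LCtx.rename_append (ρ : Label → Label) (Q R : LCtx W) :
    LCtx.rename ρ (Q ++ R) = Q.rename ρ ++ R.rename ρ :=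
  List.map_append

theorem LCtx.toCtx_append (Q R : LCtx W) : LCtx.toCtx (Q ++ R) = Q.toCtx ++ R.toCtx :=
  List.map_append

theorem LCtx.wf_toCtx {Q : LCtx W} : Q.toCtx.WF ↔ Q.Distinct := by
  have names : Q.toCtx.map Entry.name = (Q.map Prod.fst).map Sum.inr := by
    simp [LCtx.toCtx, Entry.name]
  rw [Ctx.WF, names, List.nodup_map_iff Sum.inr_injective]

theorem LCtx.exists_rename : ∀ {Q L : LCtx W}, Q.Distinct → Q.wires = L.wires →
    ∃ ρ : Label → Label, Q.rename ρ = L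
  | [], [], _, _ => ⟨id, rfl⟩
  | [], _ :: _, _, h => absurd h.symm (List.cons_ne_nil _ _)
  | _ :: _, [], _, h => absurd h (List.cons_ne_nil _ _)
  | p :: Q, q :: L, hQ, h => by
    obtain ⟨hp, hQ⟩ := List.nodup_cons.mp hQ
    obtain ⟨hpq, h⟩ := List.cons.inj h
    obtain ⟨ρ, rfl⟩ := LCtx.exists_rename hQ h
    refine ⟨Function.update ρ p.1 q.1, congrArg₂ List.cons
      (Prod.ext (Function.update_self ..) hpq) (List.map_congr_left fun r hr => ?_)⟩
    rw [Function.update_of_ne (ne_of_mem_of_not_mem (List.mem_map_of_mem hr) hp)]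

theorem LCtx.exists_distinct_rename_append {L R : LCtx W} (hL : L.Distinct) (hR : R.Distinct) :
    ∃ ρ : Label → Label, LCtx.Distinct (L.rename ρ ++ R) := by
  let n := (R.map Prod.fst).sum
  refine ⟨fun l => l + (n + 1), ?_⟩
  have labels : (L.rename fun l => l + (n + 1)).map Prod.fst =
      (L.map Prod.fst).map fun l => l + (n + 1) := by
    simp [LCtx.rename]
  rw [LCtx.Distinct, List.map_append, labels]
  refine (hL.map (add_left_injective (n + 1))).append hR fun l hlL hlR => ?_
  obtain ⟨l', -, rfl⟩ := List.mem_map.mp hlL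
  exact absurd ((Nat.le_add_left (n + 1) l').trans (List.le_sum_of_mem hlR)) n.not_succ_le_self

theorem Ctx.isParam_nil : Ctx.IsParam ([] : Ctx W) := List.forall_mem_nil _

/-- The labels of `Q`, in order, form the wire bundle `b` of type `T`: an interface of a boxed
circuit. -/
def BTy.IsInterface : BTy W → Bundle → LCtx W → Prop
  | .unit, b, Q => b = .unit ∧ Q = []
  | .wire a, b, Q => ∃ l, b = .lab l ∧ Q = [(l, a)]
  | .tensor T U, b, Q => ∃ b₁ b₂ Q₁ Q₂, b = .pair b₁ b₂ ∧ Q = Q₁ ++ Q₂ ∧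
      T.IsInterface b₁ Q₁ ∧ U.IsInterface b₂ Q₂

namespace BTy.IsInterface

theorem wires_eq : ∀ {T : BTy W} {b : Bundle} {Q : LCtx W}, T.IsInterface b Q → Q.wires = T.wires
  | .unit, _, _, ⟨_, rfl⟩ => rfl
  | .wire _, _, _, ⟨_, _, rfl⟩ => rfl
  | .tensor _ _, _, _, ⟨_, _, _, _, _, rfl, h₁, h₂⟩ =>
    (LCtx.wires_append _ _).trans (congrArg₂ _ h₁.wires_eq h₂.wires_eq)

theorem length_eq {T : BTy W} {b : Bundle} {Q : LCtx W} (h : T.IsInterface b Q) :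
    Q.length = T.wires.length := by
  rw [← h.wires_eq, List.length_map]

theorem unique : ∀ {T : BTy W} {b b' : Bundle} {Q : LCtx W},
    T.IsInterface b Q → T.IsInterface b' Q → b = b'
  | .unit, _, _, _, ⟨h, _⟩, ⟨h', _⟩ => h.trans h'.symm
  | .wire _, _, _, _, ⟨_, rfl, rfl⟩, ⟨_, rfl, hQ⟩ =>
    congrArg Bundle.lab (Prod.ext_iff.mp (List.head_eq_of_cons_eq hQ)).1
  | .tensor _ _, _, _, _, ⟨_, _, _, _, rfl, rfl, h₁, h₂⟩, ⟨_, _, _, _, rfl, hQ, h₁', h₂'⟩ => by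
    obtain ⟨rfl, rfl⟩ := List.append_inj hQ (h₁.length_eq.trans h₁'.length_eq.symm)
    exact congrArg₂ Bundle.pair (h₁.unique h₁') (h₂.unique h₂')

theorem rename (ρ : Label → Label) : ∀ {T : BTy W} {b : Bundle} {Q : LCtx W},
    T.IsInterface b Q → T.IsInterface (b.rename ρ) (Q.rename ρ)
  | .unit, _, _, ⟨rfl, rfl⟩ => ⟨rfl, rfl⟩
  | .wire _, _, _, ⟨_, rfl, rfl⟩ => ⟨_, rfl, rfl⟩
  | .tensor _ _, _, _, ⟨_, _, _, _, rfl, rfl, h₁, h₂⟩ =>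
    ⟨_, _, _, _, rfl, LCtx.rename_append .., h₁.rename ρ, h₂.rename ρ⟩

theorem nonempty_vTy : ∀ {T : BTy W} {b : Bundle} {Q : LCtx W}, T.IsInterface b Q → Q.Distinct →
    Nonempty (VTy (ι := ι) Q.toCtx b.toVal T.toTy)
  | .unit, _, _, ⟨rfl, rfl⟩, hQ => ⟨.unit Ctx.isParam_nil (LCtx.wf_toCtx.mpr hQ)⟩
  | .wire a, _, _, ⟨l, rfl, rfl⟩, hQ =>
    ⟨.lab (Φ := []) Ctx.isParam_nil l a (LCtx.wf_toCtx.mpr hQ)⟩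
  | .tensor _ _, _, _, ⟨_, _, Q₁, Q₂, rfl, rfl, h₁, h₂⟩, hQ => by
    obtain ⟨d₁⟩ := h₁.nonempty_vTy hQ.of_append_left
    obtain ⟨d₂⟩ := h₂.nonempty_vTy hQ.of_append_right
    have wf := LCtx.wf_toCtx.mpr hQ
    rw [LCtx.toCtx_append] at wf ⊢
    exact ⟨.pair (Φ := []) Ctx.isParam_nil wf d₁ d₂⟩

end BTy.IsInterface

theorem BTy.exists_fresh_interface : ∀ (T : BTy W) (s : Finset Label), ∃ (b : Bundle)
    (Q : LCtx W), T.IsInterface b Q ∧ Q.Distinct ∧ ∀ p ∈ Q, p.1 ∉ s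
  | .unit, _ => ⟨.unit, [], ⟨rfl, rfl⟩, List.nodup_nil, List.forall_mem_nil _⟩
  | .wire a, s => by
    obtain ⟨l, hl⟩ := Infinite.exists_notMem_finset s
    exact ⟨.lab l, [(l, a)], ⟨l, rfl, rfl⟩, List.nodup_singleton l,
      List.forall_mem_singleton.mpr hl⟩
  | .tensor T U, s => by
    obtain ⟨b₁, Q₁, h₁, hQ₁, fresh₁⟩ := T.exists_fresh_interface s
    obtain ⟨b₂, Q₂, h₂, hQ₂, fresh₂⟩ :=
      U.exists_fresh_interface (s ∪ (Q₁.map Prod.fst).toFinset)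
    simp only [Finset.mem_union, List.mem_toFinset, not_or] at fresh₂
    refine ⟨.pair b₁ b₂, Q₁ ++ Q₂, ⟨b₁, b₂, Q₁, Q₂, rfl, rfl, h₁, h₂⟩, ?_,
      List.forall_mem_append.mpr ⟨fresh₁, fun p hp => (fresh₂ p hp).1⟩⟩
    rw [LCtx.Distinct, List.map_append]
    refine hQ₁.append hQ₂ fun l hl₁ hl₂ => ?_
    obtain ⟨p, hp, rfl⟩ := List.mem_map.mp hl₂
    exact (fresh₂ p hp).2 hl₁

/-! ### The logical relation -/

/-- Started after any circuit whose outputs are, up to permutation, `L` and a frame `R`, the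
computation `M` evaluates to a value that satisfies `P` together with the labels `L'` it owns, and
extends the circuit by `c` next to the frame.  The two equations between sequences of wire types
only serve to compose `c` with circuits on `L ++ R` and `L' ++ R`. -/
def Run (P : Val ι → LCtx W → Prop) (M : Comp ι) (L : LCtx W) {T U : List W}
    (c : obs ι T ⟶ obs ι U) : Prop :=
  ∀ ⦃Q K : LCtx W⦄ (C : Circ ι Q K) (R : LCtx W) (σ : LPerm K (L ++ R)),
    LCtx.Distinct (L ++ R) →
    ∃ (K' : LCtx W) (D : Circ ι Q K') (V : Val ι) (L' : LCtx W) (σ' : LPerm K' (L' ++ R)),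
      LCtx.Distinct (L' ++ R) ∧ Eval C M D V ∧ P V L' ∧
      ∃ (h : LCtx.wires (L ++ R) = T ++ R.wires) (h' : U ++ R.wires = LCtx.wires (L' ++ R)),
        D ≫ σ'.perm ι = C ≫ σ.perm ι ≫ same ι h ≫ padR c R.wires ≫ same ι h'

/-- The boxed circuit `(l, C, k)` denotes `f`: the interfaces `l` and `k` list the inputs and the
outputs of `C` up to permutations, along which `C` becomes `f`. -/
def BoxDenotes (T U : BTy W) (l : Bundle) {Q K : LCtx W} (C : Circ ι Q K) (k : Bundle)
    (f : obs ι T.wires ⟶ obs ι U.wires) : Prop :=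
  ∃ (Q' K' : LCtx W) (σ : LPerm Q' Q) (τ : LPerm K K') (h : T.wires = Q'.wires)
    (h' : K'.wires = U.wires), Q'.Distinct ∧ K'.Distinct ∧ T.IsInterface l Q' ∧
      U.IsInterface k K' ∧ f = same ι h ≫ σ.perm ι ≫ C ≫ τ.perm ι ≫ same ι h'

/-- The logical relation: the closed value `V`, which owns the labels `L`, realizes an element of
`♭⟦A⟧`. -/
def Ty.Realizes : (A : Ty W) → Val ι → LCtx W → A.val ι → Prop
  | .unit, V, L, _ => V = .unit ∧ L = []
  | .nat, V, L, n => V = .nat n.down ∧ L = []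
  | .wire a, V, L, _ => ∃ l, V = .lab l ∧ L = [(l, a)]
  | .tensor A B, V, L, p => ∃ V₁ V₂ L₁ L₂, V = .pair V₁ V₂ ∧ L = L₁ ++ L₂ ∧
      A.Realizes V₁ L₁ p.1 ∧ B.Realizes V₂ L₂ p.2
  | .bang A, V, L, f => ∃ M, V = .lift M ∧ L = [] ∧ M.LCAt 0 ∧
      Run (fun X L' => A.Realizes X L' (f PUnit.unit).1) M [] (f PUnit.unit).2
  | .circ T U, V, L, f => ∃ (l k : Bundle) (Q K : LCtx W) (C : Circ ι Q K),
      V = .boxed l C k ∧ L = [] ∧ BoxDenotes T U l C k f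
  | .arrow A B T, V, L, f => ∃ M, V = .lam A M ∧ L.wires = T ∧ M.LCAt 1 ∧
      ∀ X L' a, A.Realizes X L' a →
        Run (fun Y L'' => B.Realizes Y L'' (f a).1) (M.opn X 0) (L ++ L') (f a).2

theorem Ty.Realizes.wires_eq : ∀ {A : Ty W} {V : Val ι} {L : LCtx W} {a : A.val ι},
    A.Realizes V L a → L.wires = A.wires
  | .unit, _, _, _, ⟨_, rfl⟩ | .nat, _, _, _, ⟨_, rfl⟩ | .wire _, _, _, _, ⟨_, _, rfl⟩
  | .bang _, _, _, _, ⟨_, _, rfl, _⟩ | .circ _ _, _, _, _, ⟨_, _, _, _, _, _, rfl, _⟩ => rfl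
  | .tensor _ _, _, _, _, ⟨_, _, _, _, _, rfl, h₁, h₂⟩ =>
    (LCtx.wires_append _ _).trans (congrArg₂ _ h₁.wires_eq h₂.wires_eq)
  | .arrow _ _ _, _, _, _, ⟨_, _, h, _⟩ => h

theorem Ty.Realizes.lcAt_zero : ∀ {A : Ty W} {V : Val ι} {L : LCtx W} {a : A.val ι},
    A.Realizes V L a → V.LCAt 0
  | .unit, _, _, _, ⟨rfl, _⟩ | .nat, _, _, _, ⟨rfl, _⟩ | .wire _, _, _, _, ⟨_, rfl, _⟩
  | .circ _ _, _, _, _, ⟨_, _, _, _, _, rfl, _⟩ => trivial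
  | .tensor _ _, _, _, _, ⟨_, _, _, _, rfl, _, h₁, h₂⟩ => ⟨h₁.lcAt_zero, h₂.lcAt_zero⟩
  | .bang _, _, _, _, ⟨_, rfl, _, hM, _⟩ => hM
  | .arrow _ _ _, _, _, _, ⟨_, rfl, _, hM, _⟩ => hM

theorem BTy.realizes_toTy : ∀ {T : BTy W} {V : Val ι} {L : LCtx W} {a : T.toTy.val ι},
    T.toTy.Realizes V L a ↔ ∃ b : Bundle, V = b.toVal ∧ T.IsInterface b L
  | .unit, _, _, _ =>
    ⟨fun ⟨hV, hL⟩ => ⟨.unit, hV, rfl, hL⟩, by rintro ⟨_, hV, rfl, hL⟩; exact ⟨hV, hL⟩⟩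
  | .wire _, _, _, _ =>
    ⟨fun ⟨l, hV, hL⟩ => ⟨.lab l, hV, l, rfl, hL⟩, by
      rintro ⟨_, hV, l, rfl, hL⟩; exact ⟨l, hV, hL⟩⟩
  | .tensor T U, V, L, a => by
    constructor
    · rintro ⟨_, _, L₁, L₂, rfl, rfl, h₁, h₂⟩
      obtain ⟨b₁, rfl, hb₁⟩ := BTy.realizes_toTy.mp h₁
      obtain ⟨b₂, rfl, hb₂⟩ := BTy.realizes_toTy.mp h₂
      exact ⟨.pair b₁ b₂, rfl, b₁, b₂, L₁, L₂, rfl, rfl, hb₁, hb₂⟩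
    · rintro ⟨_, rfl, b₁, b₂, L₁, L₂, rfl, rfl, h₁, h₂⟩
      exact ⟨b₁.toVal, b₂.toVal, L₁, L₂, rfl, rfl, BTy.realizes_toTy.mpr ⟨b₁, rfl, h₁⟩,
        BTy.realizes_toTy.mpr ⟨b₂, rfl, h₂⟩⟩

theorem Ty.Realizes.isInterface {T : BTy W} {b : Bundle} {L : LCtx W} {a : T.toTy.val ι}
    (h : T.toTy.Realizes (b.toVal (ι := ι)) L a) : T.IsInterface b L := by
  obtain ⟨b', hb, h'⟩ := BTy.realizes_toTy.mp h
  rwa [Bundle.toVal_injective hb]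

namespace Run

variable {P : Val ι → LCtx W → Prop} {M N : Comp ι} {V X : Val ι} {L L' : LCtx W}
  {S T U : List W}

theorem expand {c : obs ι T ⟶ obs ι U} (h : Run P M L c)
    (eval : ∀ {Q K K' : LCtx W} {C : Circ ι Q K} {D : Circ ι Q K'} {X : Val ι},
      Eval C M D X → Eval C N D X) : Run P N L c := by
  intro Q K C R σ hL
  obtain ⟨K', D, X, L', σ', hL', hD, h'⟩ := h C R σ hL
  exact ⟨K', D, X, L', σ', hL', eval hD, h'⟩

theorem permute {c : obs ι T ⟶ obs ι U} (h : Run P M L' c) (p : LPerm L L')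
    {e : obs ι S ⟶ obs ι T} (hS : S = L.wires) (hT : L'.wires = T)
    (he : e = same ι hS ≫ p.perm ι ≫ same ι hT) : Run P M L (e ≫ c) := by
  intro Q K C R σ hL
  obtain ⟨K', D, X, L'', σ', hL'', hD, hX, h₁, h₂, circuits⟩ :=
    h C R (σ.trans (p.appendRight R)) ((p.appendRight R).distinct_iff.mp hL)
  refine ⟨K', D, X, L'', σ', hL'', hD, hX, by rw [LCtx.wires_append, hS], h₂, ?_⟩
  rw [circuits, LPerm.perm, LPerm.perm_appendRight, he]
  simp only [padR_comp, padR_same, Category.assoc, same_comp_same_assoc]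

theorem same_comp {c : obs ι T ⟶ obs ι U} (h : Run P M L c) (hL : L.wires = T) (hS : S = T) :
    Run P M L (same ι hS ≫ c) :=
  h.permute (.refl L) (hS.trans hL.symm) hL
    (by rw [LPerm.perm_refl, Category.id_comp, same_comp_same])

theorem unframed {c : obs ι T ⟶ obs ι U} (h : Run P M L c) (hL : L.Distinct) {Q K : LCtx W}
    (C : Circ ι Q K) (σ : LPerm K L) :
    ∃ (K' : LCtx W) (D : Circ ι Q K') (V : Val ι) (L' : LCtx W) (σ' : LPerm K' L'),
      L'.Distinct ∧ Eval C M D V ∧ P V L' ∧ ∃ (h : L.wires = T) (h' : U = L'.wires),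
        D ≫ σ'.perm ι = C ≫ σ.perm ι ≫ same ι h ≫ c ≫ same ι h' := by
  have hnil := List.append_nil L
  obtain ⟨K', D, V, L', σ', hL', hD, hV, h₁, h₂, circuits⟩ :=
    h C [] (σ.trans (.ofEq hnil.symm)) (by rwa [hnil])
  have h₁' : L.wires = T := by simpa using h₁
  have h₂' : U = L'.wires := by simpa using h₂
  refine ⟨K', D, V, L', σ'.trans (.ofEq (List.append_nil L')), by rwa [List.append_nil] at hL',
    hD, hV, h₁', h₂', ?_⟩
  have frame : padR c (LCtx.wires ([] : LCtx W)) = _ := padR_nil c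
  rw [LPerm.perm, LPerm.perm_ofEq, reassoc_of% circuits, LPerm.perm, LPerm.perm_ofEq, frame]
  simp only [Category.assoc, same_comp_same, same_comp_same_assoc]

theorem ret (hV : P V L) (hL : L.wires = T) (h : T = U) : Run P (.ret V) L (same ι h) := by
  intro Q K C R σ hLR
  refine ⟨K, C, V, L, σ, hLR, .ret, hV, by rw [LCtx.wires_append, hL],
    by rw [LCtx.wires_append, hL, h], ?_⟩
  rw [padR_same, same_comp_same, same_comp_same, same_rfl, Category.comp_id]

theorem letin {P' : Val ι → LCtx W → Prop} {L₁ L₂ : LCtx W} {T₁ T₂ U₁ S₁ : List W}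
    {c₁ : obs ι T₁ ⟶ obs ι U₁} {c₂ : obs ι S ⟶ obs ι U} (h₁ : Run P' M L₁ c₁)
    (h₂ : ∀ X L', P' X L' → Run P (N.opn X 0) (L₂ ++ L') c₂) (hL₁ : L₁.wires = T₁)
    (hL₂ : L₂.wires = T₂) (hS₁ : S₁ = T₂ ++ T₁) (hS₂ : T₂ ++ U₁ = S) :
    Run P (.letin M N) (L₂ ++ L₁) (same ι hS₁ ≫ padL T₂ c₁ ≫ same ι hS₂ ≫ c₂) := by
  intro Q K C R σ hL
  let p₁ : LPerm (L₂ ++ L₁ ++ R) (L₁ ++ (L₂ ++ R)) :=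
    ((LPerm.blockSwap L₂ L₁).appendRight R).trans (.ofEq (List.append_assoc ..))
  obtain ⟨K₁, D₁, X, L', σ₁, hL', hD₁, hX, e₁, e₁', circuits₁⟩ :=
    h₁ C (L₂ ++ R) (σ.trans p₁) (p₁.distinct_iff.mp hL)
  let p₂ : LPerm (L' ++ (L₂ ++ R)) (L₂ ++ L' ++ R) :=
    (LPerm.ofEq (List.append_assoc ..).symm).trans ((LPerm.blockSwap L' L₂).appendRight R)
  obtain ⟨K₂, D₂, Y, L'', σ₂, hL'', hD₂, hY, e₂, e₂', circuits₂⟩ :=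
    h₂ X L' hX D₁ R (σ₁.trans p₂) (p₂.distinct_iff.mp hL')
  refine ⟨K₂, D₂, Y, L'', σ₂, hL'', .letin hD₁ hD₂, hY, ?_, e₂', ?_⟩
  · rw [LCtx.wires_append, LCtx.wires_append, hL₁, hL₂, hS₁]
  obtain rfl : U₁ = L'.wires := List.append_cancel_right (e₁'.trans (LCtx.wires_append ..))
  subst hL₁ hL₂
  -- `M` runs in the frame `L₂ ++ R`: conjugating `c₁ ⋉ L₂` by symmetries gives `L₂ ⋊ c₁`.
  rw [circuits₂, LPerm.perm, Category.assoc, reassoc_of% circuits₁,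
    padL_eq_swapBlocks_padR _ c₁, padR_congr c₁ (LCtx.wires_append L₂ R), padR_append]
  simp only [p₁, p₂, LPerm.perm, LPerm.perm_appendRight, LPerm.perm_ofEq, LPerm.perm_blockSwap,
    padR_comp, padR_same, Category.assoc, same_comp_same, same_comp_same_assoc,
    same_rfl, Category.id_comp]

theorem app {A B : Ty W} {T : List W} {f : (Ty.arrow A B T).val ι} {a : A.val ι}
    {L₁ L₂ : LCtx W} (hV : (Ty.arrow A B T).Realizes V L₁ f) (hX : A.Realizes X L₂ a)
    (hS : S = T ++ A.wires) :
    Run (B.Realizes · · (f a).1) (.app V X) (L₁ ++ L₂) (same ι hS ≫ (f a).2) := by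
  obtain ⟨M, rfl, hT, -, hM⟩ := hV
  refine ((hM X L₂ a hX).expand .app).same_comp ?_ hS
  rw [LCtx.wires_append, hT, hX.wires_eq]

theorem force {A : Ty W} {f : (Ty.bang A).val ι} (hV : (Ty.bang A).Realizes V L f)
    (hS : S = []) :
    Run (A.Realizes · · (f PUnit.unit).1) (.force V) L (same ι hS ≫ (f PUnit.unit).2) := by
  obtain ⟨M, rfl, rfl, -, hM⟩ := hV
  exact (hM.expand .force).same_comp rfl hS

theorem box {T U : BTy W} {f : (Ty.arrow T.toTy U.toTy []).val ι}
    (hV : (Ty.arrow T.toTy U.toTy []).Realizes V L f) (hS : S = []) :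
    Run ((Ty.circ T U).Realizes · · (f (T.pt ι)).2) (.box T V) L (same ι hS) := by
  obtain rfl : L = [] := List.map_eq_nil_iff.mp hV.wires_eq
  obtain ⟨l, Q, hl, hQ, fresh⟩ := T.exists_fresh_interface V.labels
  obtain ⟨dl⟩ := hl.nonempty_vTy (ι := ι) hQ
  have run : Run (U.toTy.Realizes · · (f (T.pt ι)).1) (.app V l.toVal) Q (T := T.wires)
      (U := U.wires) (same ι rfl ≫ (f (T.pt ι)).2) :=
    Run.app hV (BTy.realizes_toTy.mpr ⟨l, rfl, hl⟩) rfl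
  obtain ⟨K, D, _, L', τ, hL', hD, hX, h, h', circuits⟩ := run.unframed hQ (𝟙 _) (.refl Q)
  obtain ⟨k, rfl, hk⟩ := BTy.realizes_toTy.mp hX
  have boxed : BoxDenotes T U l D k (f (T.pt ι)).2 := by
    refine ⟨Q, L', .refl Q, τ, hl.wires_eq.symm, hk.wires_eq, hQ, hL', hl, hk, ?_⟩
    rw [reassoc_of% circuits, LPerm.perm_refl]
    simp only [Category.id_comp, same_comp_same_assoc, same_comp_same, same_rfl]
    exact (Category.comp_id _).symm
  have ret : Run ((Ty.circ T U).Realizes · · (f (T.pt ι)).2) (.ret (.boxed l D k)) [] (same ι hS) :=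
    Run.ret (L := []) ⟨l, k, Q, K, D, rfl, rfl, boxed⟩ hS.symm hS
  exact ret.expand fun | .ret => .box dl fresh hD

theorem apply {T U : BTy W} {f : (Ty.circ T U).val ι} {a : T.toTy.val ι} {L₁ L₂ : LCtx W}
    (hV : (Ty.circ T U).Realizes V L₁ f) (hX : T.toTy.Realizes X L₂ a) (u : U.toTy.val ι)
    (hS : S = T.wires) :
    Run (U.toTy.Realizes · · u) (.apply V X) (L₁ ++ L₂) (U := U.wires) (same ι hS ≫ f) := by
  refine Run.same_comp (T := T.wires) ?_ (by
    rw [LCtx.wires_append, hV.wires_eq, hX.wires_eq, Ty.wires, List.nil_append]) hS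
  obtain ⟨l, k, Q, K, E, rfl, rfl, Q', K', τ, τ', h, h', hQ', hK', hl, hk, rfl⟩ := hV
  obtain ⟨b, rfl, hb⟩ := BTy.realizes_toTy.mp hX
  obtain ⟨ρ, rfl⟩ := LCtx.exists_rename hQ' (hl.wires_eq.trans hb.wires_eq.symm)
  obtain rfl := hb.unique (hl.rename ρ)
  intro Q₀ K₀ C R σ hL
  obtain ⟨ρ', hρ'⟩ := LCtx.exists_distinct_rename_append hK' hL.of_append_right
  let p : LPerm (K.rename ρ' ++ R) (K'.rename ρ' ++ R) := (τ'.rename ρ').appendRight R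
  refine ⟨_, _, _, _, p, hρ', .apply E ρ ρ' (σ.trans ((τ.rename ρ).appendRight R))
    (p.distinct_iff.mpr hρ'), BTy.realizes_toTy.mpr ⟨_, rfl, hk.rename ρ'⟩, ?_, ?_, ?_⟩
  · rw [List.nil_append, LCtx.wires_append, hb.wires_eq]
  · rw [LCtx.wires_append, (hk.rename ρ').wires_eq]
  · simp only [append, p, LPerm.perm, LPerm.perm_appendRight, LPerm.perm_rename, padR_comp,
      padR_same, Category.assoc, same_comp_same, same_comp_same_assoc, same_rfl, Category.id_comp]

end Run

/-! ### Realized contexts -/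

/-- The value that the substitution `γ` puts in place of the name declared by an entry. -/
def Entry.inst (γ : ℕ → Val ι) : Entry W → Val ι
  | .var x _ => γ x
  | .lab l _ => .lab l

/-- The substitution `γ`, whose values jointly own the labels `L`, realizes an element of
`♭⟦Γ⟧`. -/
def Ctx.Realizes (γ : ℕ → Val ι) : (Γ : Ctx W) → LCtx W → Ctx.val ι Γ → Prop
  | [], L, _ => L = []
  | e :: Γ, L, g => ∃ L₁ L₂, L = L₁ ++ L₂ ∧ e.ty.Realizes (e.inst γ) L₁ g.1 ∧
      Ctx.Realizes γ Γ L₂ g.2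

theorem LCtx.realizes_pt (γ : ℕ → Val ι) : ∀ Q : LCtx W, Ctx.Realizes γ Q.toCtx Q (LCtx.pt Q)
  | [] => rfl
  | p :: Q => ⟨[p], Q, rfl, ⟨p.1, rfl, rfl⟩, LCtx.realizes_pt γ Q⟩

theorem Ctx.realizes_singleton {γ : ℕ → Val ι} {e : Entry W} {L : LCtx W}
    {g : Ctx.val ι [e]} : Ctx.Realizes γ [e] L g ↔ e.ty.Realizes (e.inst γ) L g.1 := by
  constructor
  · rintro ⟨L₁, _, rfl, h, rfl⟩
    rwa [List.append_nil]
  · exact fun h => ⟨L, [], (List.append_nil L).symm, h, rfl⟩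

namespace Ctx.Realizes

variable {γ γ' : ℕ → Val ι} {Φ Γ₁ Γ₂ : Ctx W}

theorem wires_eq : ∀ {Γ : Ctx W} {L : LCtx W} {g : Ctx.val ι Γ},
    Ctx.Realizes γ Γ L g → L.wires = Γ.wires
  | [], _, _, rfl => rfl
  | _ :: _, _, _, ⟨_, _, rfl, h₁, h₂⟩ =>
    (LCtx.wires_append _ _).trans (congrArg₂ _ h₁.wires_eq h₂.wires_eq)

theorem eq_nil {L : LCtx W} {g : Ctx.val ι Φ} (h : Ctx.Realizes γ Φ L g) (hΦ : Φ.IsParam) :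
    L = [] :=
  List.map_eq_nil_iff.mp (h.wires_eq.trans hΦ.wires_eq_nil)

theorem split : ∀ {Γ Δ : Ctx W} {L : LCtx W} {g : Ctx.val ι (Γ ++ Δ)},
    Ctx.Realizes γ (Γ ++ Δ) L g → ∃ L₁ L₂, L = L₁ ++ L₂ ∧
      Ctx.Realizes γ Γ L₁ (Ctx.split Γ g).1 ∧ Ctx.Realizes γ Δ L₂ (Ctx.split Γ g).2
  | [], _, L, _, h => ⟨[], L, rfl, rfl, h⟩
  | _ :: _, _, _, _, ⟨L₁, _, rfl, h₁, h⟩ =>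
    let ⟨L₂, L₃, hL, h₂, h₃⟩ := h.split
    ⟨L₁ ++ L₂, L₃, by rw [hL, List.append_assoc], ⟨L₁, L₂, rfl, h₁, h₂⟩, h₃⟩

theorem join : ∀ {Γ Δ : Ctx W} {L₁ L₂ : LCtx W} {g : Ctx.val ι Γ} {d : Ctx.val ι Δ},
    Ctx.Realizes γ Γ L₁ g → Ctx.Realizes γ Δ L₂ d →
      Ctx.Realizes γ (Γ ++ Δ) (L₁ ++ L₂) (Ctx.join g d)
  | [], _, _, _, _, _, rfl, h => h
  | _ :: _, _, _, L₃, _, _, ⟨L₁, L₂, rfl, h₁, h₂⟩, h₃ =>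
    ⟨L₁, L₂ ++ L₃, List.append_assoc .., h₁, h₂.join h₃⟩

theorem dup {L : LCtx W} {g : Ctx.val ι (Φ ++ Γ₁ ++ Γ₂)} (hΦ : Φ.IsParam)
    (h : Ctx.Realizes γ (Φ ++ Γ₁ ++ Γ₂) L g) :
    ∃ L₁ L₂, L = L₁ ++ L₂ ∧ Ctx.Realizes γ (Φ ++ Γ₁) L₁ (Ctx.dup Φ Γ₁ Γ₂ g).1 ∧
      Ctx.Realizes γ (Φ ++ Γ₂) L₂ (Ctx.dup Φ Γ₁ Γ₂ g).2 := by
  obtain ⟨L₁, L₂, hL, h₁, h₂⟩ := h.split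
  obtain ⟨L₃, _, -, h₃, -⟩ := h₁.split
  obtain rfl := h₃.eq_nil hΦ
  exact ⟨L₁, L₂, hL, h₁, h₃.join h₂⟩

theorem last {e : Entry W} {L : LCtx W} {g : Ctx.val ι (Φ ++ [e])} (hΦ : Φ.IsParam)
    (h : Ctx.Realizes γ (Φ ++ [e]) L g) : e.ty.Realizes (e.inst γ) L (Ctx.split Φ g).2.1 := by
  obtain ⟨L₁, L₂, rfl, h₁, h₂⟩ := h.split
  obtain rfl := h₁.eq_nil hΦ
  exact Ctx.realizes_singleton.mp h₂

theorem congr : ∀ {Γ : Ctx W} {L : LCtx W} {g : Ctx.val ι Γ}, Ctx.Realizes γ Γ L g →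
    (∀ x, .inl x ∈ List.map Entry.name Γ → γ x = γ' x) → Ctx.Realizes γ' Γ L g
  | [], _, _, h, _ => h
  | .var x A :: _, _, _, ⟨L₁, L₂, hL, h₁, h₂⟩, h =>
    ⟨L₁, L₂, hL, (congrArg (A.Realizes · L₁ _) (h x List.mem_cons_self)).mp h₁,
      h₂.congr fun y hy => h y (List.mem_cons_of_mem _ hy)⟩
  | .lab _ _ :: _, _, _, ⟨L₁, L₂, hL, h₁, h₂⟩, h =>
    ⟨L₁, L₂, hL, h₁, h₂.congr fun y hy => h y (List.mem_cons_of_mem _ hy)⟩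

theorem update {Γ : Ctx W} {L : LCtx W} {g : Ctx.val ι Γ} {x : ℕ} (h : Ctx.Realizes γ Γ L g)
    (hx : .inl x ∉ List.map Entry.name Γ) (X : Val ι) :
    Ctx.Realizes (Function.update γ x X) Γ L g :=
  h.congr fun y hy => (Function.update_of_ne (by rintro rfl; exact hx hy) ..).symm

theorem snoc {Γ : Ctx W} {L L' : LCtx W} {g : Ctx.val ι Γ} {x : ℕ} {A : Ty W} {X : Val ι}
    {a : A.val ι} (h : Ctx.Realizes γ Γ L g) (wf : Ctx.WF (Γ ++ [.var x A]))
    (hX : A.Realizes X L' a) :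
    Ctx.Realizes (Function.update γ x X) (Γ ++ [.var x A]) (L ++ L')
      (Ctx.join (Δ := [.var x A]) g (a, PUnit.unit)) := by
  refine (h.update (wf.name_notMem_left List.mem_cons_self) X).join (Ctx.realizes_singleton.mpr ?_)
  rwa [Entry.inst, Function.update_self]

theorem snoc₂ {Γ : Ctx W} {L L₁ L₂ : LCtx W} {g : Ctx.val ι Γ} {x y : ℕ} {A B : Ty W}
    {X Y : Val ι} {a : A.val ι} {b : B.val ι} (h : Ctx.Realizes γ Γ L g)
    (wf : Ctx.WF (Γ ++ [.var x A, .var y B])) (hX : A.Realizes X L₁ a) (hY : B.Realizes Y L₂ b) :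
    Ctx.Realizes (Function.update (Function.update γ x X) y Y) (Γ ++ [.var x A, .var y B])
      (L ++ (L₁ ++ L₂)) (Ctx.join (Δ := [.var x A, .var y B]) g (a, b, PUnit.unit)) := by
  have hx := wf.name_notMem_left (e := .var x A) List.mem_cons_self
  have hy := wf.name_notMem_left (e := .var y B) (List.mem_cons_of_mem _ List.mem_cons_self)
  have hxy : x ≠ y := by simpa [Ctx.WF, Entry.name] using wf.right
  refine ((h.update hx X).update hy Y).join ⟨L₁, L₂, rfl, ?_, Ctx.realizes_singleton.mpr ?_⟩
  · rwa [Entry.inst, Function.update_of_ne hxy, Function.update_self]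
  · rwa [Entry.inst, Function.update_self]

end Ctx.Realizes

/-! ### The fundamental lemma -/

theorem Run.exch {γ : ℕ → Val ι} {P : Val ι → LCtx W → Prop} {M : Comp ι} {Γ₁ Γ₂ : Ctx W}
    {a b : Entry W} {U : List W} {L : LCtx W} {g : Ctx.val ι (Γ₁ ++ [b] ++ [a] ++ Γ₂)}
    {c : obs ι (Ctx.wires (Γ₁ ++ [a] ++ [b] ++ Γ₂)) ⟶ obs ι U}
    (h : Ctx.Realizes γ (Γ₁ ++ [b] ++ [a] ++ Γ₂) L g)
    (hM : ∀ L', Ctx.Realizes γ (Γ₁ ++ [a] ++ [b] ++ Γ₂) L' (Ctx.exch Γ₁ Γ₂ a b g) →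
      Run P M L' c) : Run P M L (Ctx.exchPerm ι Γ₁ Γ₂ a b ≫ c) := by
  have hL := h.wires_eq
  obtain ⟨_, L₂, rfl, h', h₂⟩ := h.split
  obtain ⟨_, La, rfl, h', ha⟩ := h'.split
  obtain ⟨L₁, Lb, rfl, h₁, hb⟩ := h'.split
  have exchanged := ((h₁.join ha).join hb).join h₂
  refine (hM _ exchanged).permute (.exchBlocks L₁ Lb La L₂) hL.symm exchanged.wires_eq ?_
  have ea := ha.wires_eq
  have eb := hb.wires_eq
  rw [Ctx.wires_single] at ea eb
  rw [Ctx.exchPerm, LPerm.perm_exchBlocks, swapBlocks_congr eb ea, padR_congr _ h₂.wires_eq,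
    padL_congr h₁.wires_eq]
  simp only [padL_comp, padL_same, padR_comp, padR_same, Category.assoc, same_comp_same,
    same_comp_same_assoc]

mutual

theorem VTy.fundamental {γ : ℕ → Val ι} (hγ : ∀ x, (γ x).LCAt 0) : ∀ {Γ : Ctx W} {V : Val ι}
    {A : Ty W} (d : VTy Γ V A) {L : LCtx W} {g : Ctx.val ι Γ}, Ctx.Realizes γ Γ L g →
      A.Realizes (V.subst γ) L (d.sem g)
  | _, _, _, .unit hΦ _, _, _, h => ⟨rfl, h.eq_nil hΦ⟩
  | _, _, _, .nat hΦ _ _, _, _, h => by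
    rw [VTy.sem]
    exact ⟨rfl, h.eq_nil hΦ⟩
  | _, _, _, .lab hΦ _ _ _, _, _, h | _, _, _, .var hΦ _ _ _, _, _, h => by
    rw [VTy.sem]
    exact h.last hΦ
  | _, _, _, .abs x hx d, _, _, h => by
    rw [VTy.sem]
    refine ⟨_, rfl, h.wires_eq, d.lcAt_zero.of_opn.subst hγ, fun X L' a hX => ?_⟩
    rw [← Comp.subst_update_opn hγ hX.lcAt_zero hx]
    have extended := h.snoc d.wf hX
    exact (d.fundamental (Val.LCAt.update hγ hX.lcAt_zero x) extended).same_comp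
      extended.wires_eq _
  | _, _, _, .lift hΦ d, _, _, h => by
    rw [VTy.sem]
    obtain rfl := h.eq_nil hΦ
    exact ⟨_, rfl, rfl, d.lcAt_zero.subst hγ, (d.fundamental hγ h).same_comp h.wires_eq _⟩
  | _, _, _, .circ hΦ _ C σ τ dl dk, _, _, h => by
    rw [VTy.sem]
    have hl := dl.fundamental hγ (LCtx.realizes_pt γ _)
    have hk := dk.fundamental hγ (LCtx.realizes_pt γ _)
    rw [Bundle.subst_toVal] at hl hk
    exact ⟨_, _, _, _, C, rfl, h.eq_nil hΦ, _, _, σ, τ, _, _, LCtx.wf_toCtx.mp dl.wf,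
      LCtx.wf_toCtx.mp dk.wf, hl.isInterface, hk.isInterface, rfl⟩
  | _, _, _, .pair hΦ _ d₁ d₂, _, _, h => by
    rw [VTy.sem]
    obtain ⟨L₁, L₂, rfl, h₁, h₂⟩ := h.dup hΦ
    exact ⟨_, _, L₁, L₂, rfl, rfl, d₁.fundamental hγ h₁, d₂.fundamental hγ h₂⟩

theorem CTy.fundamental {γ : ℕ → Val ι} (hγ : ∀ x, (γ x).LCAt 0) : ∀ {Γ : Ctx W} {M : Comp ι}
    {A : Ty W} (d : CTy Γ M A) {L : LCtx W} {g : Ctx.val ι Γ}, Ctx.Realizes γ Γ L g →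
      Run (A.Realizes · · (d.sem g).1) (M.subst γ) L (d.sem g).2
  | _, _, _, .app hΦ _ d₁ d₂, _, _, h => by
    rw [CTy.sem]
    obtain ⟨L₁, L₂, rfl, h₁, h₂⟩ := h.dup hΦ
    exact Run.app (d₁.fundamental hγ h₁) (d₂.fundamental hγ h₂) _
  | _, _, _, .force hΦ d, _, _, h => by
    rw [CTy.sem]
    exact Run.force (d.fundamental hγ h) hΦ.wires_eq_nil
  | _, _, _, .box hΦ d, _, _, h => by
    rw [CTy.sem]
    exact Run.box (d.fundamental hγ h) hΦ.wires_eq_nil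
  | _, _, _, .apply hΦ _ d₁ d₂, _, _, h => by
    rw [CTy.sem]
    obtain ⟨L₁, L₂, rfl, h₁, h₂⟩ := h.dup hΦ
    exact Run.apply (d₁.fundamental hγ h₁) (d₂.fundamental hγ h₂) _ _
  | _, _, _, .dest hΦ _ x y hx hy d₁ d₂, _, _, h => by
    rw [CTy.sem]
    obtain ⟨L₂, L₁, rfl, h₂, h₁⟩ := h.dup hΦ
    obtain ⟨X, Y, La, Lb, hV, rfl, hX, hY⟩ := d₁.fundamental hγ h₁
    have hγ' := Val.LCAt.update (Val.LCAt.update hγ hX.lcAt_zero x) hY.lcAt_zero y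
    have extended := h₂.snoc₂ d₂.wf hX hY
    have body := d₂.fundamental hγ' extended
    have hxy : x ≠ y := by simpa [Ctx.WF, Entry.name] using d₂.wf.right
    rw [Comp.subst_update_opn₂ hγ hX.lcAt_zero hY.lcAt_zero hxy hx hy] at body
    rw [Comp.subst, hV]
    exact (body.expand .dest).same_comp extended.wires_eq _
  | _, _, _, .ifz hΦ d d₁ d₂, _, _, h => by
    obtain ⟨L₁, L₂, -, h₁, -⟩ := h.split
    have hV := (d.fundamental hγ h₁).1
    rw [CTy.sem, Comp.subst, hV]
    cases (d.sem (Ctx.split _ _).1).down with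
    | zero => exact (d₁.fundamental hγ h).expand .ifzZero
    | succ n => exact (d₂.fundamental hγ h).expand (.ifzSucc n)
  | _, _, _, .ret d, _, _, h => by
    rw [CTy.sem]
    exact Run.ret (d.fundamental hγ h) h.wires_eq d.wires_eq
  | _, _, _, .letin hΦ _ x hx d₁ d₂, _, _, h => by
    rw [CTy.sem]
    obtain ⟨L₂, L₁, rfl, h₂, h₁⟩ := h.dup hΦ
    refine Run.letin (d₁.fundamental hγ h₁) (fun X L' hX => ?_) h₁.wires_eq ?_ _ _
    · rw [← Comp.subst_update_opn hγ hX.lcAt_zero hx]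
      exact d₂.fundamental (Val.LCAt.update hγ hX.lcAt_zero x) (h₂.snoc d₂.wf hX)
    · rw [h₂.wires_eq, Ctx.wires_append, hΦ.wires_eq_nil, List.nil_append]
  | _, _, _, .ex d, _, _, h => by
    rw [CTy.sem]
    exact Run.exch h fun L' hL' => d.fundamental hγ hL'

end

/-! ### Configurations -/

theorem CompConfig.exists_eval {Q K Q' : LCtx W} {C : Circ ι Q K} {M : Comp ι} {A : Ty W}
    (c : CompConfig C M A Q') :
    ∃ (K' : LCtx W) (D : Circ ι Q K') (V : Val ι) (L : LCtx W) (σ : LPerm K' (L ++ Q')),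
      Eval C M D V ∧ A.Realizes V L (c.sem PUnit.unit).1 ∧
        ∃ h, D ≫ σ.perm ι = (c.sem PUnit.unit).2 ≫ same ι h := by
  have run := c.deriv.fundamental (γ := .fvar) (fun _ => trivial) (LCtx.realizes_pt _ c.L)
  rw [Comp.subst_fvar] at run
  obtain ⟨K', D, V, L, σ, -, hD, hV, h, h', circuits⟩ := run C Q' c.perm c.cod_nodup
  refine ⟨K', D, V, L, σ, hD, hV, h', ?_⟩
  rw [circuits, CompConfig.sem, KHom.comp, J]
  simp only [Category.assoc]

theorem ValConfig.realizes {Q K Q' : LCtx W} {C : Circ ι Q K} {V : Val ι} {A : Ty W}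
    (c : ValConfig C V A Q') : A.Realizes V c.L (c.sem.1 PUnit.unit) := by
  have h := c.deriv.fundamental (γ := .fvar) (fun _ => trivial) (LCtx.realizes_pt _ c.L)
  rwa [Val.subst_fvar] at h

/-- Ground types, built from `𝟙` and `Nat` by tensor products: a value of such a type is determined
by its denotation, and owns no labels. -/
def Ty.IsGround : Ty W → Prop
  | .unit | .nat => True
  | .tensor A B => A.IsGround ∧ B.IsGround
  | .wire _ | .bang _ | .circ _ _ | .arrow _ _ _ => False

theorem Ty.IsGround.isParam : ∀ {A : Ty W}, A.IsGround → A.IsParam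
  | .unit, _ | .nat, _ => trivial
  | .tensor _ _, h => ⟨h.1.isParam, h.2.isParam⟩

theorem Ty.IsParam.eq_nil_of_realizes {A : Ty W} {V : Val ι} {L : LCtx W} {a : A.val ι}
    (hA : A.IsParam) (h : A.Realizes V L a) : L = [] :=
  List.map_eq_nil_iff.mp (h.wires_eq.trans hA.wires_eq_nil)

theorem Ty.Realizes.eq_of_isGround : ∀ {A : Ty W} {V V' : Val ι} {L L' : LCtx W} {a : A.val ι},
    A.IsGround → A.Realizes V L a → A.Realizes V' L' a → V = V'
  | .unit, _, _, _, _, _, _, ⟨rfl, _⟩, ⟨rfl, _⟩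
  | .nat, _, _, _, _, _, _, ⟨rfl, _⟩, ⟨rfl, _⟩ => rfl
  | .tensor _ _, _, _, _, _, _, hA, ⟨_, _, _, _, rfl, _, h₁, h₂⟩, ⟨_, _, _, _, rfl, _, h₁', h₂'⟩ =>
    congrArg₂ _ (h₁.eq_of_isGround hA.1 h₁') (h₂.eq_of_isGround hA.2 h₂')

end PQC

theorem mainTheorem2_general {W : Type w} {𝓜 : Type u} [PQC.StrictSymmPremonoidal.{v} 𝓜]
    {ι : W → 𝓜} {Q K K' : PQC.LCtx W} {C : PQC.Circ ι Q K} {M : PQC.Comp ι}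
    {D : PQC.Circ ι Q K'} {V : PQC.Val ι} {A : PQC.Ty W} (hA : A.IsGround)
    (hM : PQC.CompConfig C M A []) (hV : PQC.ValConfig D V A []) (h : hM.sem = PQC.J hV.sem) :
    PQC.Eval C M D V := by
  obtain ⟨K₁, D₁, X, L, σ, hD₁, hX, e, circuits⟩ := hM.exists_eval
  rw [h, PQC.J] at hX circuits
  obtain rfl := hX.eq_of_isGround hA hV.realizes
  obtain rfl := hA.isParam.eq_nil_of_realizes hX
  have hL := hA.isParam.eq_nil_of_realizes hV.realizes
  obtain ⟨_, L', τ, _, d⟩ := hV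
  obtain rfl : L' = [] := hL
  obtain rfl : K₁ = [] := σ.eq_nil
  obtain rfl : K' = [] := τ.eq_nil
  obtain rfl : D₁ = D := by
    simp only [PQC.ValConfig.sem] at circuits
    rw [PQC.LPerm.perm_eq_same σ, PQC.LPerm.perm_eq_same τ] at circuits
    simpa only [Category.assoc, PQC.same_comp_same, PQC.same_rfl, Category.comp_id] using circuits
  exact hD₁

/-- Computational adequacy for Proto-Quipper-C. -/
theorem mainTheorem2 {W : Type w} {𝓜 : Type u} [PQC.StrictSymmPremonoidal.{v} 𝓜] (ι : W → 𝓜)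
    {K K' : PQC.LCtx W} (C : PQC.Circ ι [] K) (M : PQC.Comp ι)
    (D : PQC.Circ ι [] K') (V : PQC.Val ι)
    (hM : PQC.CompConfig C M PQC.Ty.unit []) (hV : PQC.ValConfig D V PQC.Ty.unit [])
    (h : hM.sem = PQC.J hV.sem) :
    PQC.Eval C M D V :=
  mainTheorem2_general (A := .unit) trivial hM hV h
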